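/- Notation. For $\ell\ge 0$ let $\mathcal P_\ell(\mathbb R^d)$ be the set of Borel probability measures $\mu$ on $\mathbb R^d$ with $\int|x|^\ell\,\mu(dx)<\infty$, and let $W_2$ be the $2$-Wasserstein distance on $\mathcal P_2(\mathbb R^d)$. Linear functional derivatives. A function $U:\mathcal P_\ell(\mathbb R^d)\to\mathbb R$ has a linear functional derivative at $\mu$ if there is a measurable $\frac{\delta U}{\delta m}(\mu,\cdot):\mathbb R^d\to\mathbb R$ with $\sup_y|\frac{\delta U}{\delta m}(\mu,y)|/(1+|y|^\ell)<\infty$ such that, for all $\nu\in\mathcal P_\ell(\mathbb R^d)$, the right derivative of $\varepsilon\mapsto U(\mu+\varepsilon(\nu-\mu))$ at $\varepsilon=0$ is $\int\frac{\delta U}{\delta m}(\mu,y)(\nu-\mu)(dy)$; it is normalised by $\frac{\delta U}{\delta m}(\mu,0)=0$. Inductively, $\frac{\delta^{j}U}{\delta m^{j}}(\mu,y_1,\dots,y_{j-1},\cdot)$ is the normalised linear functional derivative at $\mu$ of $m\mapsto\frac{\delta^{j-1}U}{\delta m^{j-1}}(m,y_1,\dots,y_{j-1})$. For $k\ge 0$,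 $\mathcal S_{j,k}(\mathcal P_\ell(\mathbb R^d))$ is the class of those $U$ for which, for every $1\le i\le j$, $\frac{\delta^iU}{\delta m^i}$ exists on $\mathcal P_\ell(\mathbb R^d)\times(\mathbb R^d)^i$, is measurable in $(x_1,\dots,x_i)$, and satisfies, for some constant $C<\infty$, $$\Big|\frac{\delta^iU}{\delta m^i}(\mu,x_1,\dots,x_i)\Big|\le C\Big(1+|x_1|^k+\dots+|x_i|^k+1_{\{\ell>0\}}\Big(\int|x|^\ell\mu(dx)\Big)^{k/\ell}\Big)\quad\text{for all }\mu,x_1,\dots,x_i.$$ The class $\mathcal M_2(\mathcal P_2(\mathbb R^d))$. Let $(\Omega,\mathcal F,\mathbb P)$ be an atomless probability space. $U:\mathcal P_2(\mathbb R^d)\to\mathbb R$ is L-differentiable at $\mu$ with L-derivative $\partial_\mu U(\mu,\cdot)=h$, where $h:\mathbb R^d\to\mathbb R^d$ is Borel, if the lift $\theta\mapsto U(\mathrm{Law}(\theta))$ on $L^2(\Omega;\mathbb R^d)$ is Fréchet differentiable at some $\theta_0$ with law $\mu$, with gradient $h(\theta_0)$. The second L-derivative is $(\partial_\mu^2U(\mu,v_1,v_2))_{i_1i_2}=\big(\partial_\mu\big[(\partial_\mu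 U(\cdot,v_1))_{i_1}\big](\mu,v_2)\big)_{i_2}$. The class $\mathcal M_2(\mathcal P_2(\mathbb R^d))$ consists of all $U$ for which $\partial_\mu U(\mu,v)$, $\partial_v\partial_\mu U(\mu,v)$ and $\partial^2_\mu U(\mu,v_1,v_2)$ exist and have versions that are bounded and Lipschitz continuous in all variables, with respect to $W_2$ in the measure and the Euclidean norm in $v,v_1,v_2$. Statement. Let $U\in\mathcal M_2(\mathcal P_2(\mathbb R^d))$. Then the linear functional derivatives of $U$ of orders one and two exist on $\mathcal P_2(\mathbb R^d)$, and there is a constant $C<\infty$ such that for all $\mu\in\mathcal P_2(\mathbb R^d)$ and $x,y,\tilde y\in\mathbb R^d$ $$\Big|\frac{\delta^2U}{\delta m^2}(\mu,x,y)-\frac{\delta^2U}{\delta m^2}(\mu,x,\tilde y)\Big|\le C\,|x|\,|y-\tilde y|.$$ Moreover, for every real $\ell\ge 4$ the restriction of $U$ to $\mathcal P_\ell(\mathbb R^d)$ satisfies: $U\in\mathcal S_{1,\ell/2}(\mathcal P_\ell(\mathbb R^d))\cap\mathcal S_{2,\ell}(\mathcal P_\ell(\mathbb R^d))$, and for some $\alpha\in(0,1_{\{\ell=0\}}+\ell\wedge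 1]$ the map $y\mapsto\frac{\delta^2U}{\delta m^2}(\mu,x,y)/(1+|x|^{\ell/2})$ is globally Hölder continuous with exponent $\alpha$, uniformly in $(\mu,x)\in\mathcal P_\ell(\mathbb R^d)\times\mathbb R^d$. -/

import Mathlib

open MeasureTheory Filter Topology
open scoped ENNReal

noncomputable section

namespace WassersteinCalculus

/-- `ℝᵈ` with its Euclidean norm. -/
abbrev Rd (d : ℕ) : Type := EuclideanSpace ℝ (Fin d)

/-! ### The spaces `𝒫_ℓ(ℝᵈ)` and the Wasserstein metric -/

/-- `𝒫_ℓ(ℝᵈ)`: the Borel probability measures on `ℝᵈ` with finite moment of order `ℓ`. -/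
def PM (d : ℕ) (ℓ : ℝ) : Type :=
  {μ : Measure (Rd d) // IsProbabilityMeasure μ ∧ ∫⁻ x, ‖x‖ₑ ^ ℓ ∂μ < ∞}

/-- The underlying measure. -/
def PM.toMeasure {d : ℕ} {ℓ : ℝ} (μ : PM d ℓ) : Measure (Rd d) := μ.1

instance {d : ℕ} {ℓ : ℝ} (μ : PM d ℓ) : IsProbabilityMeasure μ.toMeasure := μ.2.1

/-- The moment `∫ |x|^ℓ μ(dx)`, a finite number for `μ ∈ 𝒫_ℓ(ℝᵈ)`. -/
def PM.moment {d : ℕ} {ℓ : ℝ} (μ : PM d ℓ) : ℝ := ∫ x, ‖x‖ ^ ℓ ∂μ.toMeasure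

/-- The inclusion `𝒫_ℓ(ℝᵈ) ⊆ 𝒫_k(ℝᵈ)` for `0 ≤ k ≤ ℓ`. -/
def PM.incl {d : ℕ} {k ℓ : ℝ} (hk : 0 ≤ k) (hkl : k ≤ ℓ) (μ : PM d ℓ) : PM d k :=
  ⟨μ.toMeasure, inferInstance, by
    have h : ∀ x : Rd d, ‖x‖ₑ ^ k ≤ 1 + ‖x‖ₑ ^ ℓ := by
      intro x
      rcases le_total ‖x‖ₑ 1 with h1 | h1
      · exact (ENNReal.rpow_le_one h1 hk).trans le_self_add
      · exact (ENNReal.rpow_le_rpow_of_exponent_le h1 hkl).trans le_add_self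
    refine (lintegral_mono h).trans_lt ?_
    rw [lintegral_add_left measurable_const]
    exact ENNReal.add_lt_top.2 ⟨by simp, μ.2.2⟩⟩

/-- The mixture `μ + t (ν - μ) = (1 - t) μ + t ν`, `t ∈ [0, 1]`. -/
def PM.mix {d : ℕ} {ℓ : ℝ} (μ ν : PM d ℓ) (t : Set.Icc (0 : ℝ) 1) : PM d ℓ :=
  ⟨ENNReal.ofReal (1 - t) • μ.toMeasure + ENNReal.ofReal t • ν.toMeasure,
    ⟨by
      have h0 : (0 : ℝ) ≤ 1 - t := by linarith [t.2.2]
      simp [← ENNReal.ofReal_add h0 t.2.1]⟩, by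
    rw [lintegral_add_measure, lintegral_smul_measure, lintegral_smul_measure]
    exact ENNReal.add_lt_top.2 ⟨ENNReal.mul_lt_top ENNReal.ofReal_lt_top μ.2.2,
      ENNReal.mul_lt_top ENNReal.ofReal_lt_top ν.2.2⟩⟩

/-- `ρ` is a coupling of `μ` and `ν`. -/
def IsCoupling {d : ℕ} (ρ : Measure (Rd d × Rd d)) (μ ν : Measure (Rd d)) : Prop :=
  ρ.map Prod.fst = μ ∧ ρ.map Prod.snd = ν

/-- The Wasserstein distance `W_ℓ` on `𝒫_ℓ(ℝᵈ)`, for `ℓ > 0`: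
the infimum over all couplings `ρ` of `(∫ |x - y|^ℓ ρ(dx, dy)) ^ (1 / (ℓ ∨ 1))`. -/
def wasserstein {d : ℕ} {ℓ : ℝ} (μ ν : PM d ℓ) : ℝ :=
  (⨅ (ρ : Measure (Rd d × Rd d)) (_ : IsCoupling ρ μ.toMeasure ν.toMeasure),
    (∫⁻ p, ‖p.1 - p.2‖ₑ ^ ℓ ∂ρ) ^ (1 / max ℓ 1)).toReal

/-! ### Linear functional derivatives -/

/-- `f` is a (not necessarily normalised) linear functional derivative of `U` at `μ`: it is
measurable, has growth of order `ℓ`, and for every `ν ∈ 𝒫_ℓ(ℝᵈ)` the right derivative at `ε = 0`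
of `U(μ + ε (ν - μ))` is `∫ f d(ν - μ)`. (The curve is frozen for `ε` outside `[0, 1]`.) -/
def IsLinDeriv {d : ℕ} {ℓ : ℝ} (U : PM d ℓ → ℝ) (μ : PM d ℓ) (f : Rd d → ℝ) : Prop :=
  Measurable f ∧ (∃ C : ℝ, ∀ y, |f y| ≤ C * (1 + ‖y‖ ^ ℓ)) ∧
    ∀ ν : PM d ℓ, HasDerivWithinAt
      (fun ε : ℝ => U (μ.mix ν (Set.projIcc 0 1 zero_le_one ε)))
      ((∫ y, f y ∂ν.toMeasure) - ∫ y, f y ∂μ.toMeasure) (Set.Ici 0) 0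

open Classical in
/-- The linear functional derivative `δU/δm(μ, ·)`, normalised to vanish at `0`. -/
def linDeriv {d : ℕ} {ℓ : ℝ} (U : PM d ℓ → ℝ) (μ : PM d ℓ) (y : Rd d) : ℝ :=
  if h : ∃ f, IsLinDeriv U μ f then h.choose y - h.choose 0 else 0

/-- The linear functional derivative of order `j`, obtained by differentiating
`m ↦ δʲU/δmʲ(m, y₁, …, yⱼ)` with the first arguments fixed; the new variable is the last one. -/
def linDerivIter {d : ℕ} {ℓ : ℝ} (U : PM d ℓ → ℝ) : (j : ℕ) → PM d ℓ → (Fin j → Rd d) → ℝ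
  | 0, μ, _ => U μ
  | j + 1, μ, y => linDeriv (fun m => linDerivIter U j m (Fin.init y)) μ (y (Fin.last j))

/-- The linear functional derivatives of `U` of orders `1, …, j` exist at every point of
`𝒫_ℓ(ℝᵈ)`. -/
def HasLinDerivs {d : ℕ} {ℓ : ℝ} (j : ℕ) (U : PM d ℓ → ℝ) : Prop :=
  ∀ i < j, ∀ (μ : PM d ℓ) (y : Fin i → Rd d),
    ∃ f, IsLinDeriv (fun m => linDerivIter U i m y) μ f

open Classical in
/-- The class `𝒮_{j,k}(𝒫_ℓ(ℝᵈ))`. -/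
def ClassS {d : ℕ} {ℓ : ℝ} (j : ℕ) (k : ℝ) (U : PM d ℓ → ℝ) : Prop :=
  HasLinDerivs j U ∧
  (∀ i ∈ Finset.Icc 1 j, ∀ μ, Measurable (linDerivIter U i μ)) ∧
  ∃ C : ℝ, ∀ i ∈ Finset.Icc 1 j, ∀ (μ : PM d ℓ) (x : Fin i → Rd d),
    |linDerivIter U i μ x| ≤
      C * (1 + (∑ a, ‖x a‖ ^ k) + if 0 < ℓ then μ.moment ^ (k / ℓ) else 0)

open Classical in
/-- The hypotheses on `U : 𝒫_ℓ(ℝᵈ) → ℝ` of the central limit theorem: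
`U ∈ 𝒮_{1,ℓ/2}(𝒫_ℓ) ∩ 𝒮_{2,ℓ}(𝒫_ℓ)` and, for some `α ∈ (0, 1_{ℓ=0} + ℓ ∧ 1]`, the map
`y ↦ δ²U/δm²(μ, x, y) / (1 + |x|^{ℓ/2})` is globally `α`-Hölder, uniformly in `(μ, x)`. -/
def CLTHypotheses {d : ℕ} {ℓ : ℝ} (U : PM d ℓ → ℝ) : Prop :=
  ClassS 1 (ℓ / 2) U ∧ ClassS 2 ℓ U ∧
  ∃ α ∈ Set.Ioc (0 : ℝ) ((if ℓ = 0 then 1 else 0) + min ℓ 1), ∃ C : ℝ,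
    ∀ (μ : PM d ℓ) (x y y' : Rd d),
      |linDerivIter U 2 μ ![x, y] / (1 + ‖x‖ ^ (ℓ / 2))
        - linDerivIter U 2 μ ![x, y'] / (1 + ‖x‖ ^ (ℓ / 2))| ≤ C * ‖y - y'‖ ^ α

/-! ### L-derivatives and the class `ℳ₂(𝒫₂(ℝᵈ))` -/

/-- A measure is atomless if every measurable set of positive measure contains a measurable set
of smaller positive measure. -/
def IsAtomless {Ω : Type*} [MeasurableSpace Ω] (P : Measure Ω) : Prop :=
  ∀ A, MeasurableSet A → 0 < P A → ∃ B ⊆ A, MeasurableSet B ∧ 0 < P B ∧ P B < P A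

/-- The law of a square-integrable random vector, an element of `𝒫₂(ℝᵈ)`. -/
def law {Ω : Type*} [MeasurableSpace Ω] {P : Measure Ω} [IsProbabilityMeasure P] {d : ℕ}
    (θ : Lp (Rd d) 2 P) : PM d 2 :=
  ⟨P.map θ, Measure.isProbabilityMeasure_map (Lp.aestronglyMeasurable θ).aemeasurable, by
    rw [lintegral_map' (by fun_prop) (Lp.aestronglyMeasurable θ).aemeasurable]
    have h := lintegral_rpow_enorm_lt_top_of_eLpNorm_lt_top (p := 2) (by norm_num) (by norm_num)
      (Lp.memLp θ).2
    simpa using h⟩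

/-- The lift `Ũ(θ) = U(law of θ)` of `U` to `L²(Ω; ℝᵈ)`. -/
def lift {Ω : Type*} [MeasurableSpace Ω] (P : Measure Ω) [IsProbabilityMeasure P] {d : ℕ}
    (U : PM d 2 → ℝ) (θ : Lp (Rd d) 2 P) : ℝ := U (law θ)

/-- `U` is L-differentiable at `μ` and the Borel map `h` is a version of the L-derivative
`∂_μ U(μ)`: the lift is Fréchet differentiable at some `θ` with law `μ`, and the gradient of the
lift at `θ` (the element of `L²` that represents its Fréchet derivative) is `h(θ)`. -/
def HasLDeriv {Ω : Type*} [MeasurableSpace Ω] (P : Measure Ω) [IsProbabilityMeasure P] {d : ℕ}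
    (U : PM d 2 → ℝ) (μ : PM d 2) (h : Rd d → Rd d) : Prop :=
  Measurable h ∧ ∃ θ L : Lp (Rd d) 2 P,
    law θ = μ ∧ HasGradientAt (lift P U) L θ ∧ L =ᵐ[P] fun ω => h (θ ω)

/-- The Hilbert-Schmidt norm of a matrix. -/
def hsNorm {d : ℕ} (A : Matrix (Fin d) (Fin d) ℝ) : ℝ := √(∑ i, ∑ j, A i j ^ 2)

/-- The class `ℳ₂(𝒫₂(ℝᵈ))`: the derivatives `∂_μ U(μ, v)`, `∂_v ∂_μ U(μ, v)` and
`∂_μ² U(μ, v₁, v₂)` (these are all derivatives of orders one and two; `U` itself is not required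
to be bounded) exist, are bounded, and are Lipschitz continuous in all variables. As L-derivatives
are only defined almost everywhere, this means that they have versions with these properties.
The `i`-th row of `∂_μ² U(μ, v₁, ·)` is the L-derivative at `μ` of `m ↦ ∂_μ U(m, v₁)ᵢ`. -/
def ClassM2 {Ω : Type*} [MeasurableSpace Ω] (P : Measure Ω) [IsProbabilityMeasure P] {d : ℕ}
    (U : PM d 2 → ℝ) : Prop :=
  ∃ (DU : PM d 2 → Rd d → Rd d)
    (DvDU : PM d 2 → Rd d → Matrix (Fin d) (Fin d) ℝ)
    (DDU : PM d 2 → Rd d → Rd d → Matrix (Fin d) (Fin d) ℝ) (C : ℝ),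
    0 < C ∧
    -- the three functions are the derivatives of `U`
    (∀ μ, HasLDeriv P U μ (DU μ)) ∧
    (∀ μ v i j, HasLineDerivAt ℝ (fun w => DU μ w i) (DvDU μ v i j) v
      (EuclideanSpace.single j 1)) ∧
    (∀ μ v i, HasLDeriv P (fun m => DU m v i) μ (fun w => WithLp.toLp 2 (DDU μ v w i))) ∧
    -- they are bounded
    (∀ μ v, ‖DU μ v‖ ≤ C) ∧
    (∀ μ v, hsNorm (DvDU μ v) ≤ C) ∧
    (∀ μ v w, hsNorm (DDU μ v w) ≤ C) ∧
    -- they are Lipschitz continuous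
    (∀ μ μ' v v', ‖DU μ v - DU μ' v'‖ ≤ C * (‖v - v'‖ + wasserstein μ μ')) ∧
    (∀ μ μ' v v', hsNorm (DvDU μ v - DvDU μ' v') ≤ C * (‖v - v'‖ + wasserstein μ μ')) ∧
    (∀ μ μ' v v' w w', hsNorm (DDU μ v w - DDU μ' v' w') ≤
      C * (‖v - v'‖ + ‖w - w'‖ + wasserstein μ μ'))

/-! ### The linear functional derivative is well defined -/

/-- The Dirac mass at `y`. -/
def PM.dirac {d : ℕ} {ℓ : ℝ} (hl : 0 ≤ ℓ) (y : Rd d) : PM d ℓ :=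
  ⟨Measure.dirac y, inferInstance, by
    rw [lintegral_dirac]; exact ENNReal.rpow_lt_top_of_nonneg hl (by simp)⟩

/-- All linear functional derivatives of `U` at `μ` differ by constants, so the normalised
derivative does not depend on the choice made in its definition. -/
theorem IsLinDeriv.linDeriv_eq {d : ℕ} {ℓ : ℝ} (hl : 0 ≤ ℓ) {U : PM d ℓ → ℝ} {μ : PM d ℓ}
    {f : Rd d → ℝ} (hf : IsLinDeriv U μ f) (y : Rd d) : linDeriv U μ y = f y - f 0 := by
  have hex : ∃ f, IsLinDeriv U μ f := ⟨f, hf⟩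
  have key : ∀ z, hex.choose z - ∫ x, hex.choose x ∂μ.toMeasure
      = f z - ∫ x, f x ∂μ.toMeasure := by
    intro z
    have h1 := hex.choose_spec.2.2 (PM.dirac hl z)
    have h2 := hf.2.2 (PM.dirac hl z)
    have h3 := (uniqueDiffWithinAt_Ici (0 : ℝ)).eq_deriv _ h1 h2
    simpa [PM.dirac, PM.toMeasure] using h3
  rw [linDeriv, dif_pos hex]
  linarith [key y, key 0]

end WassersteinCalculus

end

open WassersteinCalculus

namespace WassersteinCalculus

/-! ### Atomless measures take all intermediate values -/

section Atomless

variable {Ω : Type*} [MeasurableSpace Ω] {P : Measure Ω} [IsFiniteMeasure P]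

/-! Write D for the L-derivative of `U` and H_i for the L-derivative of the i-th component of D. The
linear functional derivatives are the line integrals ∫₀¹ D(μ, tx)·x dt and ∫₀¹∫₀¹ Σ_i x_i H_i(μ, tx,
sy)·y ds dt, which vanish at x = 0 and at y = 0 respectively. Boundedness of D and H bounds them by
C|x| and dC|x||y|, and for ℓ ≥ 4 the growth and Hölder conditions follow by elementary inequalities,
with Hölder exponent 1.

The core is a first-order expansion of a functional V with bounded Lipschitz L-derivative along
mixtures. If X, Y lie within L²-distance R of Z with law μ, integrating the derivative of the lift
from X to Y, with the measure argument frozen at μ, costs an error C R E|Y - X|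
(`IsLipGrad.abs_lift_sub_le`). Perturb Z ∼ μ only on an event of probability t: there X is a fixed
point a and Y ∼ ν, independent of Z. Then R is of order √t and E|Y - X| of order t, so the error is
O(t√t) (`exists_mix_dirac_expansion`). Passing from μ to the mixture through the Dirac mixture at a
= 0 makes all paths start at 0, so the line integral from 0 appears as the derivative. The error is
uniform over functionals with the same C. The second order therefore follows by applying the
expansion to D(·, rx)_i and integrating over r (`exists_secondLin_expansion`).

L-differentiability supplies a Fréchet derivative at only one random variable of each law.
Atomlessness transfers it to arbitrary spaces: any simple pair (θ, η) can be copied in law with a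
prescribed first component (`IsAtomless.exists_map_eq`). General pairs are reached by simple
approximation.

The Lipschitz bound in y needs one more fact: the L-derivative is conservative in its space variable
(`IsLipGrad.segInt_sub_segInt`), so an increment of the potential is a line integral along the
segment between the two points. -/

theorem IsAtomless.exists_subset_real_le_half (hP : IsAtomless P) {A : Set Ω}
    (hA : MeasurableSet A) (h0 : 0 < P.real A) :
    ∃ B ⊆ A, MeasurableSet B ∧ 0 < P.real B ∧ P.real B ≤ P.real A / 2 := by
  obtain ⟨B, hBA, hB, hB0, hBlt⟩ := hP A hA
    (by rw [Measure.real] at h0; exact (ENNReal.toReal_pos_iff.1 h0).1)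
  have h1 : 0 < P.real B := ENNReal.toReal_pos hB0.ne' (measure_ne_top _ _)
  have h2 : P.real B < P.real A :=
    (ENNReal.toReal_lt_toReal (measure_ne_top _ _) (measure_ne_top _ _)).2 hBlt
  have h3 : P.real (A \ B) = P.real A - P.real B := measureReal_sdiff hBA hB
  rcases le_total (P.real B) (P.real A / 2) with h | h
  · exact ⟨B, hBA, hB, h1, h⟩
  · exact ⟨A \ B, Set.sdiff_subset, hA.diff hB, by linarith, by linarith⟩

theorem IsAtomless.exists_subset_real_lt (hP : IsAtomless P) {A : Set Ω}
    (hA : MeasurableSet A) (h0 : 0 < P.real A) {ε : ℝ} (hε : 0 < ε) :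
    ∃ B ⊆ A, MeasurableSet B ∧ 0 < P.real B ∧ P.real B < ε := by
  have key : ∀ n : ℕ, ∃ B ⊆ A, MeasurableSet B ∧ 0 < P.real B ∧
      P.real B ≤ P.real A * (1 / 2) ^ n := by
    intro n
    induction n with
    | zero => exact ⟨A, subset_rfl, hA, h0, by simp⟩
    | succ n ih =>
      obtain ⟨B, hBA, hB, hB0, hBle⟩ := ih
      obtain ⟨B', h1, h2, h3, h4⟩ := hP.exists_subset_real_le_half hB hB0
      exact ⟨B', h1.trans hBA, h2, h3, h4.trans (by rw [pow_succ]; linarith)⟩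
  have ht : Tendsto (fun n : ℕ => P.real A * (1 / 2 : ℝ) ^ n) atTop (𝓝 (P.real A * 0)) :=
    (tendsto_pow_atTop_nhds_zero_of_lt_one (by norm_num) (by norm_num)).const_mul _
  rw [mul_zero] at ht
  obtain ⟨n, hn⟩ := (ht.eventually (gt_mem_nhds hε)).exists
  obtain ⟨B, h1, h2, h3, h4⟩ := key n
  exact ⟨B, h1, h2, h3, h4.trans_lt hn⟩

/-- **Sierpiński's theorem**: a finite atomless measure takes every intermediate value. -/
theorem IsAtomless.exists_subset_real_eq (hP : IsAtomless P) {A : Set Ω}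
    (hA : MeasurableSet A) {c : ℝ} (hc0 : 0 ≤ c) (hc : c ≤ P.real A) :
    ∃ B ⊆ A, MeasurableSet B ∧ P.real B = c := by
  let F := {B : Set Ω // B ⊆ A ∧ MeasurableSet B ∧ P.real B ≤ c}
  -- Greedy choice: some extension B' achieves at least half of every possible gain over B.
  -- Otherwise gains could be doubled repeatedly and would exceed c.
  have step : ∀ B : F, ∃ B' : F, B.1 ⊆ B'.1 ∧
      ∀ B'' : F, B.1 ⊆ B''.1 → P.real B''.1 - P.real B.1 ≤ 2 * (P.real B'.1 - P.real B.1) := by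
    intro B
    by_contra! hcon
    have key : ∀ n : ℕ, ∀ B' : F, B.1 ⊆ B'.1 → 2 ^ n * (P.real B'.1 - P.real B.1) ≤ c := by
      intro n
      induction n with
      | zero =>
        intro B' hB'
        have h1 := B'.2.2.2
        have h2 : 0 ≤ P.real B.1 := measureReal_nonneg
        linarith
      | succ n ih =>
        intro B' hB'
        obtain ⟨B'', h1, h2⟩ := hcon B' hB'
        have h3 := ih B'' h1
        have h4 : (0 : ℝ) < 2 ^ n := by positivity
        rw [pow_succ]
        nlinarith
    obtain ⟨B', h1, h2⟩ := hcon B subset_rfl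
    rw [sub_self, mul_zero] at h2
    obtain ⟨n, hn⟩ := pow_unbounded_of_one_lt (c / (P.real B'.1 - P.real B.1)) one_lt_two
    rw [div_lt_iff₀ h2] at hn
    exact absurd (key n B' h1) hn.not_ge
  choose next hsub hnext using step
  let B : ℕ → F := fun n => Nat.rec ⟨∅, Set.empty_subset _, MeasurableSet.empty, by simpa⟩
    (fun _ B => next B) n
  have hmono : Monotone fun n => (B n).1 := monotone_nat_of_le_succ fun n => hsub (B n)
  have hUm : MeasurableSet (⋃ n, (B n).1) := MeasurableSet.iUnion fun n => (B n).2.2.1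
  have hUA : (⋃ n, (B n).1) ⊆ A := Set.iUnion_subset fun n => (B n).2.1
  have hlim : Tendsto (fun n => P.real (B n).1) atTop (𝓝 (P.real (⋃ n, (B n).1))) :=
    (ENNReal.tendsto_toReal (measure_ne_top _ _)).comp (tendsto_measure_iUnion_atTop hmono)
  have hUc : P.real (⋃ n, (B n).1) ≤ c := le_of_tendsto' hlim fun n => (B n).2.2.2
  refine ⟨_, hUA, hUm, ?_⟩
  by_contra hne
  have hlt : P.real (⋃ n, (B n).1) < c := lt_of_le_of_ne hUc hne
  have hd : P.real (A \ ⋃ n, (B n).1) = P.real A - P.real (⋃ n, (B n).1) :=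
    measureReal_sdiff hUA hUm
  obtain ⟨C, hC1, hC2, hC3, hC4⟩ := hP.exists_subset_real_lt (hA.diff hUm)
    (by linarith) (sub_pos.2 hlt)
  have hdisj : Disjoint (⋃ n, (B n).1) C := Set.disjoint_sdiff_right.mono_right hC1
  have hUC : P.real ((⋃ n, (B n).1) ∪ C) = P.real (⋃ n, (B n).1) + P.real C :=
    measureReal_union hdisj hC2
  let D : F := ⟨(⋃ n, (B n).1) ∪ C, Set.union_subset hUA (hC1.trans Set.sdiff_subset),
    hUm.union hC2, by linarith⟩
  -- The set D competes at every stage, while the increments of the greedy sequence tend to 0; so D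
  -- cannot have larger measure than the union.
  have h1 : ∀ n, P.real D.1 - P.real (B n).1 ≤ 2 * (P.real (B (n + 1)).1 - P.real (B n).1) :=
    fun n => hnext (B n) D ((Set.subset_iUnion (fun n => (B n).1) n).trans Set.subset_union_left)
  have h2 := le_of_tendsto_of_tendsto' (hlim.const_sub (P.real D.1))
    (((hlim.comp (tendsto_add_atTop_nat 1)).sub hlim).const_mul 2) h1
  have h3 : P.real D.1 = P.real (⋃ n, (B n).1) + P.real C := hUC
  linarith

/-- A finitely supported refinement of the distribution of a random variable on an atomless space
can be realised by a partition. -/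
theorem IsAtomless.exists_partition (hP : IsAtomless P) {F G : Type*} [DecidableEq F]
    [DecidableEq G] [MeasurableSpace G]
    [MeasurableSingletonClass G] {θ : Ω → G} (hθ : Measurable θ) (q : F → G) {p : F → ℝ}
    (hp : ∀ i, 0 ≤ p i) (s : Finset F) :
    ∀ A : Set Ω, MeasurableSet A →
    (∀ z, P.real (A ∩ θ ⁻¹' {z}) = ∑ i ∈ s, if q i = z then p i else 0) →
    ∃ B : F → Set Ω, (∀ i, MeasurableSet (B i)) ∧
      (∀ i ∈ s, B i ⊆ A ∩ θ ⁻¹' {q i} ∧ P.real (B i) = p i) ∧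
      (s : Set F).PairwiseDisjoint B := by
  induction s using Finset.induction_on with
  | empty => exact fun A _ _ => ⟨fun _ => ∅, by simp, by simp, by simp⟩
  | insert a s ha ih =>
    intro A hA hsum
    have hm : ∀ z, MeasurableSet (A ∩ θ ⁻¹' {z}) :=
      fun z => hA.inter (hθ (measurableSet_singleton z))
    have hle : p a ≤ P.real (A ∩ θ ⁻¹' {q a}) := by
      rw [hsum, Finset.sum_insert ha, if_pos rfl]
      exact le_add_of_nonneg_right (Finset.sum_nonneg fun i _ => by split_ifs <;> simp [hp])
    obtain ⟨B₀, h1, h2, h3⟩ := hP.exists_subset_real_eq (hm (q a)) (hp a) hle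
    -- Removing B₀ takes mass `p a` from the fibre over `q a` and nothing from the other fibres, so
    -- the mass identity persists for `s`.
    obtain ⟨B, hB1, hB2, hB3⟩ := ih (A \ B₀) (hA.diff h2) (by
      intro z
      have hz := hsum z
      rw [Finset.sum_insert ha] at hz
      have hset : (A \ B₀) ∩ θ ⁻¹' {z} = (A ∩ θ ⁻¹' {z}) \ B₀ := by
        ext ω; simp only [Set.mem_inter_iff, Set.mem_sdiff]; tauto
      rw [hset]
      by_cases hza : q a = z
      · subst hza
        rw [if_pos rfl] at hz
        rw [measureReal_sdiff h1 h2, h3]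
        linarith
      · rw [if_neg hza, zero_add] at hz
        have : (A ∩ θ ⁻¹' {z}) \ B₀ = A ∩ θ ⁻¹' {z} := by
          refine sdiff_eq_left.2 (Set.disjoint_left.2 fun ω hω hω' => hza ?_)
          exact (h1 hω').2.symm.trans hω.2
        rw [this, hz])
    refine ⟨Function.update B a B₀, fun i => ?_, fun i hi => ?_, ?_⟩
    · rcases eq_or_ne i a with rfl | hne
      · simpa using h2
      · simpa [hne] using hB1 i
    · rcases eq_or_ne i a with rfl | hne
      · simpa using ⟨Set.subset_inter_iff.1 h1, h3⟩
      · have := hB2 i ((Finset.mem_insert.1 hi).resolve_left hne)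
        rw [Function.update_of_ne hne]
        exact ⟨this.1.trans (Set.inter_subset_inter_left _ Set.sdiff_subset), this.2⟩
    · have hne : ∀ i ∈ s, i ≠ a := fun i hi h => ha (h ▸ hi)
      rw [Finset.coe_insert]
      refine Set.PairwiseDisjoint.insert ?_ ?_
      · intro i hi j hj hij
        simpa [Function.onFun, hne i hi, hne j hj] using hB3 hi hj hij
      · intro i hi _
        rw [Function.update_self, Function.update_of_ne (hne i hi)]
        exact (Set.disjoint_sdiff_right.mono_right
          (((hB2 i hi).1).trans Set.inter_subset_left))

end Atomless

/-! ### Realising a simple law with a prescribed image -/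

section Realisation

variable {Ω : Type*} [MeasurableSpace Ω] {P : Measure Ω} [IsProbabilityMeasure P]
variable {S : Type*} [MeasurableSpace S] {π : Measure S} [IsProbabilityMeasure π]

open Classical in
theorem simpleFunc_real_preimage {F : Type*} [MeasurableSpace F] (f : SimpleFunc S F) (A : Set F) :
    π.real (f ⁻¹' A) = ∑ i ∈ f.range, if i ∈ A then π.real (f ⁻¹' {i}) else 0 := by
  rw [← Finset.sum_filter]
  have h : f ⁻¹' A = ⋃ i ∈ f.range.filter (· ∈ A), f ⁻¹' {i} := by
    ext s
    simp
  rw [h, measureReal_biUnion_finset]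
  · intro i _ j _ hij
    exact Disjoint.preimage _ (by simpa using hij)
  · exact fun i _ => f.measurableSet_fiber i

/-- On an atomless space, a random variable with the law of `q ∘ f`, `f` simple, can be completed
to a random variable with the law of `f`. -/
theorem IsAtomless.exists_map_eq (hP : IsAtomless P) {F G : Type*} [AddCommMonoid F]
    [MeasurableSpace F] [MeasurableAdd₂ F] [MeasurableSingletonClass F] [MeasurableSpace G]
    [MeasurableSingletonClass G] {θ : Ω → G} (hθ : Measurable θ) {q : F → G} (hq : Measurable q)
    (f : SimpleFunc S F) (h : P.map θ = π.map (fun s => q (f s))) :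
    ∃ T : Ω → F, Measurable T ∧ P.map T = π.map f ∧ ∀ᵐ ω ∂P, q (T ω) = θ ω := by
  classical
  obtain ⟨B, hB, hBp, hBd⟩ := hP.exists_partition hθ q (p := fun i => π.real (f ⁻¹' {i}))
    (fun _ => measureReal_nonneg) f.range Set.univ MeasurableSet.univ (by
      intro z
      have h1 : (P.map θ).real {z} = (π.map fun s => q (f s)).real {z} := by rw [h]
      rw [map_measureReal_apply hθ (measurableSet_singleton z),
        map_measureReal_apply (show Measurable fun s => q (f s) from hq.comp f.measurable)
          (measurableSet_singleton z)] at h1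
      rw [Set.univ_inter, h1]
      exact simpleFunc_real_preimage f (q ⁻¹' {z}))
  -- Equal to i on `B i`, and to 0 outside their union, which is a null set.
  let T : Ω → F := fun ω => ∑ i ∈ f.range, (B i).indicator (fun _ => i) ω
  have hT : Measurable T :=
    Finset.measurable_sum _ fun i _ => measurable_const.indicator (hB i)
  have hTB : ∀ i ∈ f.range, ∀ ω ∈ B i, T ω = i := by
    intro i hi ω hω
    refine (Finset.sum_eq_single i (fun j hj hji => ?_) (fun h => absurd hi h)).trans
      (Set.indicator_of_mem hω _)
    exact Set.indicator_of_notMem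
      (fun hj' => Set.disjoint_left.1 (hBd hj hi hji) hj' hω) _
  -- One inequality is enough, since both laws have total mass 1.
  have hle : ∀ A : Set F, MeasurableSet A → π.real (f ⁻¹' A) ≤ P.real (T ⁻¹' A) := by
    intro A hA
    rw [simpleFunc_real_preimage, ← Finset.sum_filter,
      ← Finset.sum_congr rfl fun i hi => (hBp i (Finset.mem_filter.1 hi).1).2,
      ← measureReal_biUnion_finset
        (hBd.subset (by intro i hi; exact (Finset.mem_filter.1 hi).1)) fun i _ => hB i]
    refine measureReal_mono (Set.iUnion₂_subset fun i hi ω hω => ?_)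
    rw [Finset.mem_filter] at hi
    rw [Set.mem_preimage, hTB i hi.1 ω hω]
    exact hi.2
  have hUn : P.real (⋃ i ∈ f.range, B i) = 1 := by
    rw [measureReal_biUnion_finset hBd fun i _ => hB i,
      Finset.sum_congr rfl fun i hi => (hBp i hi).2]
    have := simpleFunc_real_preimage (π := π) f Set.univ
    simpa using this.symm
  refine ⟨T, hT, ?_, ?_⟩
  · have := Measure.isProbabilityMeasure_map (μ := P) hT.aemeasurable
    have := Measure.isProbabilityMeasure_map (μ := π) f.measurable.aemeasurable
    symm
    refine Measure.eq_of_le_of_isProbabilityMeasure (Measure.le_iff.2 fun A hA => ?_)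
    rw [Measure.map_apply hT hA, Measure.map_apply f.measurable hA]
    exact (ENNReal.toReal_le_toReal (measure_ne_top _ _) (measure_ne_top _ _)).1 (hle A hA)
  · have hm : MeasurableSet (⋃ i ∈ f.range, B i) := Finset.measurableSet_biUnion _ fun i _ => hB i
    have : ∀ᵐ ω ∂P, ω ∈ ⋃ i ∈ f.range, B i := by
      rw [ae_iff]
      refine (measureReal_eq_zero_iff (measure_ne_top _ _)).1 ?_
      have := probReal_compl_eq_one_sub (μ := P) hm
      rw [hUn, sub_self] at this
      exact this
    filter_upwards [this] with ω hω
    obtain ⟨i, hi, hωi⟩ := Set.mem_iUnion₂.1 hω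
    rw [hTB i hi ω hωi]
    exact (((hBp i hi).1 hωi).2).symm

end Realisation

theorem Lp_measurable {d : ℕ} {S : Type*} [MeasurableSpace S] {π : Measure S}
    (θ : Lp (Rd d) 2 π) : Measurable θ :=
  (Lp.stronglyMeasurable θ).measurable

/-! ### Transfer of the lift to other probability spaces -/

section Lifts

variable {d : ℕ}
variable {Ω : Type*} [MeasurableSpace Ω] {P : Measure Ω} [IsProbabilityMeasure P]
variable {S : Type*} [MeasurableSpace S] {π : Measure S} [IsProbabilityMeasure π]

theorem law_toMeasure (θ : Lp (Rd d) 2 P) : (law θ).toMeasure = P.map θ := rfl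

theorem PM.ext {ℓ : ℝ} {μ ν : PM d ℓ} (h : μ.toMeasure = ν.toMeasure) : μ = ν := Subtype.ext h

theorem law_add_smul_toMeasure (θ η : Lp (Rd d) 2 P) (h : ℝ) :
    (law (θ + h • η)).toMeasure
      = (P.map fun ω => (θ ω, η ω)).map fun p : Rd d × Rd d => p.1 + h • p.2 := by
  rw [Measure.map_map (by fun_prop) ((Lp_measurable θ).prodMk (Lp_measurable η)), law_toMeasure]
  refine Measure.map_congr ?_
  filter_upwards [Lp.coeFn_add θ (h • η), Lp.coeFn_smul h η] with ω h1 h2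
  rw [h1, Pi.add_apply, h2]; rfl

/-- The lift is differentiable along simple directions at every simple random variable, on every
probability space. -/
theorem HasLDeriv.hasDerivAt_lift_zero (hP : IsAtomless P) {V : PM d 2 → ℝ} {D : Rd d → Rd d}
    {θ η : Lp (Rd d) 2 π} (hD : HasLDeriv P V (law θ) D) (f : SimpleFunc S (Rd d × Rd d))
    (hf : ∀ᵐ s ∂π, f s = (θ s, η s)) :
    HasDerivAt (fun h : ℝ => lift π V (θ + h • η)) (∫ s, inner ℝ (D (θ s)) (η s) ∂π) 0 := by
  obtain ⟨hDm, θ₀, L, hlaw, hgrad, hL⟩ := hD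
  have hmap : P.map θ₀ = π.map fun s => (f s).1 := by
    rw [← law_toMeasure, hlaw, law_toMeasure]
    refine Measure.map_congr ?_
    filter_upwards [hf] with s hs
    rw [hs]
  -- The second component of T is a direction at θ₀ such that the pair has the joint law of (θ, η).
  -- That joint law determines the law of θ + hη for every h, so the two lifts agree along these
  -- lines.
  obtain ⟨T, hT, hTmap, hTθ⟩ := hP.exists_map_eq (Lp_measurable θ₀) measurable_fst f hmap
  have hjoint : π.map f = π.map fun s => (θ s, η s) := Measure.map_congr hf
  have hη₀ : MemLp (fun ω => (T ω).2) 2 P := by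
    have h1 : MemLp (fun p : Rd d × Rd d => p.2) 2 (π.map fun s => (θ s, η s)) :=
      (memLp_map_measure_iff (by fun_prop)
        ((Lp_measurable θ).prodMk (Lp_measurable η)).aemeasurable).2 (Lp.memLp η)
    rw [← hjoint, ← hTmap] at h1
    exact (memLp_map_measure_iff (by fun_prop) hT.aemeasurable).1 h1
  let η₀ : Lp (Rd d) 2 P := hη₀.toLp _
  have hη₀c : η₀ =ᵐ[P] fun ω => (T ω).2 := hη₀.coeFn_toLp
  have hj : P.map (fun ω => (θ₀ ω, η₀ ω)) = π.map fun s => (θ s, η s) := by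
    rw [← hjoint, ← hTmap]
    refine Measure.map_congr ?_
    filter_upwards [hTθ, hη₀c] with ω h1 h2
    rw [← h1, h2]
  have hfun : (fun h : ℝ => lift π V (θ + h • η)) = fun h : ℝ => lift P V (θ₀ + h • η₀) := by
    funext h
    refine congrArg V (PM.ext ?_)
    rw [law_add_smul_toMeasure, law_add_smul_toMeasure, hj]
  rw [hfun]
  have hder := hgrad.hasFDerivAt.hasLineDerivAt η₀
  rw [HasLineDerivAt] at hder
  refine hder.congr_deriv ?_
  simp only [InnerProductSpace.toDual_apply_apply, L2.inner_def]
  have hk : Measurable fun p : Rd d × Rd d => (inner ℝ (D p.1) p.2 : ℝ) :=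
    Measurable.inner (𝕜 := ℝ) (hDm.comp measurable_fst) measurable_snd
  have e1 : ∫ s, (inner ℝ (D (θ s)) (η s) : ℝ) ∂π
      = ∫ p, (inner ℝ (D p.1) p.2 : ℝ) ∂(π.map fun s => (θ s, η s)) :=
    (integral_map ((Lp_measurable θ).prodMk (Lp_measurable η)).aemeasurable
      hk.aestronglyMeasurable).symm
  rw [e1, ← hj, integral_map ((Lp_measurable θ₀).prodMk (Lp_measurable η₀)).aemeasurable
      hk.aestronglyMeasurable]
  refine integral_congr_ae ?_
  filter_upwards [hL] with ω hω
  rw [hω]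

theorem wasserstein_law_le (θ θ' : Lp (Rd d) 2 π) :
    wasserstein (law θ) (law θ') ≤ ‖θ - θ'‖ := by
  have hm : Measurable fun s => (θ s, θ' s) := (Lp_measurable θ).prodMk (Lp_measurable θ')
  rw [Lp.norm_def]
  refine ENNReal.toReal_mono (Lp.eLpNorm_ne_top _) ?_
  have hc : IsCoupling (π.map fun s => (θ s, θ' s)) (law θ).toMeasure (law θ').toMeasure := by
    constructor
    · rw [Measure.map_map measurable_fst hm]; rfl
    · rw [Measure.map_map measurable_snd hm]; rfl
  refine iInf₂_le_of_le _ hc ?_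
  · rw [lintegral_map (by fun_prop) hm,
      eLpNorm_eq_lintegral_rpow_enorm_toReal (by norm_num) (by norm_num)]
    simp only [ENNReal.toReal_ofNat]
    rw [max_eq_left (by norm_num)]
    refine ENNReal.rpow_le_rpow (le_of_eq ?_) (by norm_num)
    refine lintegral_congr_ae ?_
    filter_upwards [Lp.coeFn_sub θ θ'] with s hs
    rw [hs]; rfl

end Lifts

/-! ### Exchanging expectation and line integrals -/

section Fubini

variable {S : Type*} [MeasurableSpace S] {π : Measure S} [IsFiniteMeasure π]
  {k : ℝ → S → ℝ} {b : S → ℝ}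

theorem integrable_uncurry_of_bound (hk : Measurable (Function.uncurry k)) (hb : Integrable b π)
    (hkb : ∀ t ∈ Set.Ioc (0 : ℝ) 1, ∀ s, |k t s| ≤ b s) :
    Integrable (Function.uncurry k) ((volume.restrict (Set.Ioc (0 : ℝ) 1)).prod π) := by
  have h1 : Integrable (fun p : ℝ × S => b p.2) ((volume.restrict (Set.Ioc (0 : ℝ) 1)).prod π) :=
    hb.comp_snd _
  refine h1.mono' hk.aestronglyMeasurable ?_
  have h2 : ∀ᵐ p ∂((volume.restrict (Set.Ioc (0 : ℝ) 1)).prod π), p.1 ∈ Set.Ioc (0 : ℝ) 1 :=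
    Measure.quasiMeasurePreserving_fst.ae (ae_restrict_mem measurableSet_Ioc)
  filter_upwards [h2] with p hp using hkb p.1 hp p.2

theorem integral_intervalIntegral_comm (hk : Measurable (Function.uncurry k))
    (hb : Integrable b π) (hkb : ∀ t ∈ Set.Ioc (0 : ℝ) 1, ∀ s, |k t s| ≤ b s) :
    ∫ s, (∫ t in (0 : ℝ)..1, k t s) ∂π = ∫ t in (0 : ℝ)..1, ∫ s, k t s ∂π := by
  simp only [intervalIntegral.integral_of_le zero_le_one]
  exact (integral_integral_swap (integrable_uncurry_of_bound hk hb hkb)).symm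

theorem intervalIntegrable_integral (hk : Measurable (Function.uncurry k))
    (hb : Integrable b π) (hkb : ∀ t ∈ Set.Ioc (0 : ℝ) 1, ∀ s, |k t s| ≤ b s) :
    IntervalIntegrable (fun t => ∫ s, k t s ∂π) volume 0 1 :=
  (intervalIntegrable_iff_integrableOn_Ioc_of_le zero_le_one).2
    (integrable_uncurry_of_bound hk hb hkb).integral_prod_left

theorem abs_intervalIntegral_le {h : ℝ → ℝ} {c : ℝ} (hc : ∀ t ∈ Set.Ioc (0 : ℝ) 1, |h t| ≤ c) :
    |∫ t in (0 : ℝ)..1, h t| ≤ c := by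
  have := intervalIntegral.norm_integral_le_of_norm_le_const (a := (0 : ℝ)) (b := 1) (f := h)
    (C := c) (by simpa [Set.uIoc_of_le] using hc)
  simpa using this

end Fubini

/-- The integral of the vector field `D` along the segment from `a` to `b`. -/
noncomputable def segInt {d : ℕ} (D : Rd d → Rd d) (a b : Rd d) : ℝ :=
  ∫ t in (0 : ℝ)..1, inner ℝ (D (a + t • (b - a))) (b - a)

theorem abs_segInt_le {d : ℕ} {D : Rd d → Rd d} {C : ℝ} (hD : ∀ v, ‖D v‖ ≤ C) (a b : Rd d) :
    |segInt D a b| ≤ C * ‖b - a‖ :=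
  abs_intervalIntegral_le fun _ _ => (abs_real_inner_le_norm _ _).trans
    (mul_le_mul_of_nonneg_right (hD _) (norm_nonneg _))

theorem continuous_segInt {d : ℕ} {D : Rd d → Rd d} (hD : Continuous D) :
    Continuous fun p : Rd d × Rd d => segInt D p.1 p.2 := by
  refine intervalIntegral.continuous_parametric_intervalIntegral_of_continuous' ?_ 0 1
  fun_prop

/-- `V` is L-differentiable everywhere, with an L-derivative `D` that is bounded by `C` and
`C`-Lipschitz in all variables. -/
structure IsLipGrad {Ω : Type*} [MeasurableSpace Ω] (P : Measure Ω) [IsProbabilityMeasure P]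
    {d : ℕ} (V : PM d 2 → ℝ) (D : PM d 2 → Rd d → Rd d) (C : ℝ) : Prop where
  nonneg : 0 ≤ C
  hasLDeriv : ∀ μ, HasLDeriv P V μ (D μ)
  bound : ∀ μ v, ‖D μ v‖ ≤ C
  lip : ∀ μ μ' v v', ‖D μ v - D μ' v'‖ ≤ C * (‖v - v'‖ + wasserstein μ μ')

theorem Lp_coeFn_segment {d : ℕ} {S : Type*} [MeasurableSpace S] {π : Measure S}
    (θ θ' : Lp (Rd d) 2 π) (t : ℝ) :
    ∀ᵐ s ∂π, (θ + t • (θ' - θ)) s = θ s + t • (θ' s - θ s) ∧ (θ' - θ) s = θ' s - θ s := by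
  filter_upwards [Lp.coeFn_add θ (t • (θ' - θ)), Lp.coeFn_smul t (θ' - θ), Lp.coeFn_sub θ' θ]
    with s h1 h2 h3
  constructor
  · rw [h1, Pi.add_apply, h2, Pi.smul_apply, h3, Pi.sub_apply]
  · rw [h3, Pi.sub_apply]

/-! ### Expansion along a segment of random variables -/

section LipGrad

variable {d : ℕ}
variable {Ω : Type*} [MeasurableSpace Ω] {P : Measure Ω} [IsProbabilityMeasure P]
variable {S : Type*} [MeasurableSpace S] {π : Measure S} [IsProbabilityMeasure π]
variable {V : PM d 2 → ℝ} {D : PM d 2 → Rd d → Rd d} {C : ℝ}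

theorem IsLipGrad.norm_apply_sub_le (hD : IsLipGrad P V D C) (μ : PM d 2) (v v' : Rd d) :
    ‖D μ v - D μ v'‖ ≤ C * ‖v - v'‖ := by
  -- Realising μ as the law of θ gives W₂(μ, μ) ≤ 0 through the diagonal coupling.
  obtain ⟨-, θ, -, rfl, -⟩ := hD.hasLDeriv μ
  have h := wasserstein_law_le θ θ
  rw [sub_self, norm_zero] at h
  exact (hD.lip _ _ v v').trans (mul_le_mul_of_nonneg_left (by linarith) hD.nonneg)

theorem IsLipGrad.continuous (hD : IsLipGrad P V D C) (μ : PM d 2) : Continuous (D μ) := by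
  refine (LipschitzWith.of_dist_le_mul (K := ⟨C, hD.nonneg⟩) fun v v' => ?_).continuous
  rw [dist_eq_norm, dist_eq_norm]
  exact hD.norm_apply_sub_le μ v v'

theorem integrable_norm_sub (θ θ' : Lp (Rd d) 2 π) : Integrable (fun s => ‖θ' s - θ s‖) π :=
  (((Lp.memLp θ').integrable one_le_two).sub ((Lp.memLp θ).integrable one_le_two)).norm

theorem IsLipGrad.hasDerivAt_segment (hP : IsAtomless P) (hD : IsLipGrad P V D C)
    {θ θ' : Lp (Rd d) 2 π} (f : SimpleFunc S (Rd d × Rd d))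
    (hf : ∀ᵐ s ∂π, f s = (θ s, θ' s)) (t : ℝ) :
    HasDerivAt (fun t : ℝ => lift π V (θ + t • (θ' - θ)))
      (∫ s, inner ℝ (D (law (θ + t • (θ' - θ))) (θ s + t • (θ' s - θ s))) (θ' s - θ s) ∂π) t := by
  have h0 := (hD.hasLDeriv (law (θ + t • (θ' - θ)))).hasDerivAt_lift_zero (η := θ' - θ) hP
    (f.map fun p => (p.1 + t • (p.2 - p.1), p.2 - p.1)) (by
      filter_upwards [hf, Lp_coeFn_segment θ θ' t] with s h1 h2
      rw [SimpleFunc.map_apply, h1, h2.1, h2.2])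
  have h1 : HasDerivAt (fun r : ℝ => r - t) 1 t := (hasDerivAt_id t).sub_const t
  have h2 := HasDerivAt.comp (h := fun r : ℝ => r - t) t
    (by simp only [sub_self]; exact h0) h1
  rw [mul_one] at h2
  have e : (fun t : ℝ => lift π V (θ + t • (θ' - θ)))
      = (fun h : ℝ => lift π V (θ + t • (θ' - θ) + h • (θ' - θ))) ∘ fun r => r - t := by
    funext r
    simp only [Function.comp_apply]
    congr 1
    module
  rw [e]
  refine h2.congr_deriv (integral_congr_ae ?_)
  filter_upwards [Lp_coeFn_segment θ θ' t] with s hs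
  rw [hs.1, hs.2]

/-- First-order expansion between two simple random variables, with the L-derivative frozen
at a nearby law. -/
theorem IsLipGrad.abs_lift_sub_le_of_simple (hP : IsAtomless P) (hD : IsLipGrad P V D C)
    {θ θ' ζ : Lp (Rd d) 2 π} (f : SimpleFunc S (Rd d × Rd d))
    (hf : ∀ᵐ s ∂π, f s = (θ s, θ' s)) {R : ℝ} (h : ‖θ - ζ‖ ≤ R) (h' : ‖θ' - ζ‖ ≤ R) :
    |lift π V θ' - lift π V θ - ∫ s, segInt (D (law ζ)) (θ s) (θ' s) ∂π|
      ≤ C * R * ∫ s, ‖θ' s - θ s‖ ∂π := by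
  set φ : ℝ → ℝ := fun t => lift π V (θ + t • (θ' - θ)) with hφ
  set φ' : ℝ → ℝ := fun t => ∫ s, inner ℝ (D (law (θ + t • (θ' - θ))) (θ s + t • (θ' s - θ s)))
    (θ' s - θ s) ∂π with hφ'
  set k : ℝ → S → ℝ := fun t s => inner ℝ (D (law ζ) (θ s + t • (θ' s - θ s))) (θ' s - θ s) with hk
  have hθ := Lp_measurable θ
  have hθ' := Lp_measurable θ'
  have hcont : ∀ (μ : PM d 2) (t : ℝ), Measurable fun s =>
      (inner ℝ (D μ (θ s + t • (θ' s - θ s))) (θ' s - θ s) : ℝ) := by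
    intro μ t
    have := (hD.continuous μ).measurable
    fun_prop
  have hbd : ∀ (μ : PM d 2) (t : ℝ) s, |(inner ℝ (D μ (θ s + t • (θ' s - θ s))) (θ' s - θ s) : ℝ)|
      ≤ C * ‖θ' s - θ s‖ := fun μ t s => (abs_real_inner_le_norm _ _).trans
        (mul_le_mul_of_nonneg_right (hD.bound _ _) (norm_nonneg _))
  have hint := integrable_norm_sub θ θ'
  have hintC := hint.const_mul C
  have hinner : ∀ (μ : PM d 2) (t : ℝ), Integrable (fun s =>
      (inner ℝ (D μ (θ s + t • (θ' s - θ s))) (θ' s - θ s) : ℝ)) π := fun μ t =>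
    hintC.mono' (hcont μ t).aestronglyMeasurable (Eventually.of_forall (hbd μ t))
  have hder : ∀ t, HasDerivAt φ (φ' t) t := fun t => hD.hasDerivAt_segment hP f hf t
  have hφi : IntervalIntegrable φ' volume 0 1 := by
    -- Measurability in t is free, because φ' is a derivative.
    have hm : Measurable φ' := by
      have : φ' = deriv φ := funext fun t => (hder t).deriv.symm
      rw [this]
      exact measurable_deriv φ
    rw [intervalIntegrable_iff_integrableOn_Ioc_of_le zero_le_one]
    refine Integrable.mono' (integrable_const (C * ∫ s, ‖θ' s - θ s‖ ∂π))
      hm.aestronglyMeasurable (Eventually.of_forall fun t => ?_)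
    rw [← integral_const_mul]
    exact norm_integral_le_of_norm_le hintC (Eventually.of_forall (hbd _ t))
  have hkm : Measurable (Function.uncurry k) := by
    have := (hD.continuous (law ζ)).measurable
    simp only [hk, Function.uncurry_def]
    fun_prop
  have hkb : ∀ t ∈ Set.Ioc (0 : ℝ) 1, ∀ s, |k t s| ≤ C * ‖θ' s - θ s‖ :=
    fun t _ s => hbd _ t s
  have hftc : ∫ t in (0 : ℝ)..1, φ' t = φ 1 - φ 0 :=
    intervalIntegral.integral_eq_sub_of_hasDerivAt (fun t _ => hder t) hφi
  have e1 : φ 1 = lift π V θ' := by simp [hφ]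
  have e0 : φ 0 = lift π V θ := by simp [hφ]
  have hswap : ∫ s, segInt (D (law ζ)) (θ s) (θ' s) ∂π = ∫ t in (0 : ℝ)..1, ∫ s, k t s ∂π :=
    integral_intervalIntegral_comm hkm hintC hkb
  rw [← e1, ← e0, ← hftc, hswap,
    ← intervalIntegral.integral_sub hφi (intervalIntegrable_integral hkm hintC hkb)]
  refine abs_intervalIntegral_le fun t ht => ?_
  rw [← integral_sub (hinner _ t) (hinner _ t), ← integral_const_mul, ← Real.norm_eq_abs]
  refine norm_integral_le_of_norm_le (hint.const_mul _) (Eventually.of_forall fun s => ?_)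
  rw [← inner_sub_left]
  refine (norm_inner_le_norm _ _).trans (mul_le_mul_of_nonneg_right ?_ (norm_nonneg _))
  refine (hD.lip _ _ _ _).trans ?_
  rw [sub_self, norm_zero, zero_add]
  refine mul_le_mul_of_nonneg_left ((wasserstein_law_le _ _).trans ?_) hD.nonneg
  -- The whole segment stays in the ball around ζ, so freezing the measure at the law of ζ costs at
  -- most C R.
  have := (convex_closedBall ζ R).add_smul_sub_mem (x := θ) (y := θ')
    (by simpa [dist_eq_norm] using h) (by simpa [dist_eq_norm] using h') ⟨ht.1.le, ht.2⟩
  simpa [dist_eq_norm] using this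

end LipGrad

/-! ### From simple to general random variables -/

/-- Simple maps of `ℝᵈ` that converge pointwise to the identity. -/
noncomputable def simpleApprox (d n : ℕ) : SimpleFunc (Rd d) (Rd d) :=
  SimpleFunc.approxOn id measurable_id Set.univ 0 (Set.mem_univ _) n

theorem norm_simpleApprox_le {d : ℕ} (n : ℕ) (x : Rd d) : ‖simpleApprox d n x‖ ≤ 2 * ‖x‖ := by
  have := SimpleFunc.norm_approxOn_zero_le (f := (id : Rd d → Rd d)) measurable_id
    (Set.mem_univ (0 : Rd d)) x n
  rw [two_mul]
  exact this

theorem tendsto_simpleApprox {d : ℕ} (x : Rd d) :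
    Tendsto (fun n => simpleApprox d n x) atTop (𝓝 x) :=
  SimpleFunc.tendsto_approxOn measurable_id (Set.mem_univ (0 : Rd d)) (by simp)

section

variable {d : ℕ} {S : Type*} [MeasurableSpace S] {π : Measure S} [IsProbabilityMeasure π]

theorem memLp_simpleApprox_comp (n : ℕ) (θ : Lp (Rd d) 2 π) :
    MemLp (fun s => simpleApprox d n (θ s)) 2 π :=
  ((simpleApprox d n).comp θ (Lp_measurable θ)).memLp_of_isFiniteMeasure 2 π

/-- The simple random variable `s_n(θ)`. -/
noncomputable def simpleTrunc (n : ℕ) (θ : Lp (Rd d) 2 π) : Lp (Rd d) 2 π :=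
  (memLp_simpleApprox_comp n θ).toLp _

theorem coeFn_simpleTrunc (n : ℕ) (θ : Lp (Rd d) 2 π) :
    simpleTrunc n θ =ᵐ[π] fun s => simpleApprox d n (θ s) :=
  (memLp_simpleApprox_comp n θ).coeFn_toLp

theorem tendsto_simpleTrunc (θ : Lp (Rd d) 2 π) :
    Tendsto (fun n => simpleTrunc n θ) atTop (𝓝 θ) := by
  rw [Lp.tendsto_Lp_iff_tendsto_eLpNorm']
  have h := SimpleFunc.tendsto_approxOn_Lp_eLpNorm (p := 2) (μ := π.map θ)
    (f := (id : Rd d → Rd d)) measurable_id (Set.mem_univ (0 : Rd d)) (by norm_num) (by simp) (by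
      have := (memLp_map_measure_iff (p := 2) (f := θ) (g := (id : Rd d → Rd d)) (by fun_prop)
        (Lp_measurable θ).aemeasurable).2 (Lp.memLp θ)
      simpa [Function.id_def] using this.2)
  refine h.congr fun n => ?_
  rw [eLpNorm_map_measure (by fun_prop) (Lp_measurable θ).aemeasurable]
  refine eLpNorm_congr_ae ?_
  filter_upwards [coeFn_simpleTrunc n θ] with s hs
  simp only [Function.comp_apply, Pi.sub_apply, hs]
  rfl

theorem law_simpleTrunc_toMeasure (n : ℕ) (θ : Lp (Rd d) 2 π) :
    (law (simpleTrunc n θ)).toMeasure = (law θ).toMeasure.map (simpleApprox d n) := by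
  rw [law_toMeasure, law_toMeasure, Measure.map_map (simpleApprox d n).measurable
    (Lp_measurable θ)]
  exact Measure.map_congr (coeFn_simpleTrunc n θ)

/-- Continuity of the lift is known only at θ₀, but the law of a truncation depends only on the law
truncated, so convergence along truncations of θ₀ is convergence along those of θ. -/
theorem HasLDeriv.tendsto_lift_simpleTrunc {Ω : Type*} [MeasurableSpace Ω] {P : Measure Ω}
    [IsProbabilityMeasure P] {V : PM d 2 → ℝ} {D : Rd d → Rd d} {θ : Lp (Rd d) 2 π}
    (hD : HasLDeriv P V (law θ) D) :
    Tendsto (fun n => lift π V (simpleTrunc n θ)) atTop (𝓝 (lift π V θ)) := by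
  obtain ⟨-, θ₀, L, hlaw, hgrad, -⟩ := hD
  have h := hgrad.hasFDerivAt.continuousAt.tendsto.comp (tendsto_simpleTrunc θ₀)
  have e : lift P V θ₀ = lift π V θ := congrArg V hlaw
  rw [e] at h
  refine h.congr fun n => congrArg V (PM.ext ?_)
  rw [law_simpleTrunc_toMeasure, law_simpleTrunc_toMeasure, hlaw]

theorem tendsto_integral_simpleTrunc (θ θ' : Lp (Rd d) 2 π) {k : Rd d × Rd d → ℝ}
    (hk : Continuous k) {c : ℝ} (hc : ∀ p, |k p| ≤ c * (‖p.1‖ + ‖p.2‖)) :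
    Tendsto (fun n => ∫ s, k (simpleTrunc n θ s, simpleTrunc n θ' s) ∂π) atTop
      (𝓝 (∫ s, k (θ s, θ' s) ∂π)) := by
  have hc' : ∀ p, |k p| ≤ |c| * (‖p.1‖ + ‖p.2‖) := fun p =>
    (hc p).trans (mul_le_mul_of_nonneg_right (le_abs_self c) (by positivity))
  have hcongr : ∀ n, ∫ s, k (simpleTrunc n θ s, simpleTrunc n θ' s) ∂π
      = ∫ s, k (simpleApprox d n (θ s), simpleApprox d n (θ' s)) ∂π := by
    intro n
    refine integral_congr_ae ?_
    filter_upwards [coeFn_simpleTrunc n θ, coeFn_simpleTrunc n θ'] with s h1 h2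
    rw [h1, h2]
  simp only [hcongr]
  have hi : Integrable (fun s => |c| * (2 * ‖θ s‖ + 2 * ‖θ' s‖)) π :=
    ((((Lp.memLp θ).integrable one_le_two).norm.const_mul 2).add
      (((Lp.memLp θ').integrable one_le_two).norm.const_mul 2)).const_mul _
  refine tendsto_integral_of_dominated_convergence _ (fun n => ?_) hi (fun n => ?_) ?_
  · exact (hk.measurable.comp (((simpleApprox d n).measurable.comp (Lp_measurable θ)).prodMk
      ((simpleApprox d n).measurable.comp (Lp_measurable θ')))).aestronglyMeasurable
  · refine Eventually.of_forall fun s => (hc' _).trans ?_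
    have h1 := norm_simpleApprox_le n (θ s)
    have h2 := norm_simpleApprox_le n (θ' s)
    gcongr
  · exact Eventually.of_forall fun s => (hk.tendsto _).comp
      ((tendsto_simpleApprox (θ s)).prodMk_nhds (tendsto_simpleApprox (θ' s)))

/-- First-order expansion between two random variables, with the L-derivative frozen at a nearby
law. -/
theorem IsLipGrad.abs_lift_sub_le {Ω : Type*} [MeasurableSpace Ω] {P : Measure Ω}
    [IsProbabilityMeasure P] (hP : IsAtomless P) {V : PM d 2 → ℝ}
    {D : PM d 2 → Rd d → Rd d} {C : ℝ} (hD : IsLipGrad P V D C)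
    {θ θ' ζ : Lp (Rd d) 2 π} {R : ℝ} (h : ‖θ - ζ‖ ≤ R) (h' : ‖θ' - ζ‖ ≤ R) :
    |lift π V θ' - lift π V θ - ∫ s, segInt (D (law ζ)) (θ s) (θ' s) ∂π|
      ≤ C * R * ∫ s, ‖θ' s - θ s‖ ∂π := by
  -- The radius is enlarged so that the ball around ζ contains both truncations; it tends back to R.
  let Rn : ℕ → ℝ := fun n => R + ‖simpleTrunc n θ - θ‖ + ‖simpleTrunc n θ' - θ'‖
  have hR : Tendsto Rn atTop (𝓝 R) := by
    have h1 := (tendsto_iff_norm_sub_tendsto_zero.1 (tendsto_simpleTrunc θ))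
    have h2 := (tendsto_iff_norm_sub_tendsto_zero.1 (tendsto_simpleTrunc θ'))
    simpa using (h1.const_add R).add h2
  have hsimple : ∀ n, |lift π V (simpleTrunc n θ') - lift π V (simpleTrunc n θ)
      - ∫ s, segInt (D (law ζ)) (simpleTrunc n θ s) (simpleTrunc n θ' s) ∂π|
      ≤ C * Rn n * ∫ s, ‖simpleTrunc n θ' s - simpleTrunc n θ s‖ ∂π := by
    intro n
    refine hD.abs_lift_sub_le_of_simple hP
      (((simpleApprox d n).comp θ (Lp_measurable θ)).pair
        ((simpleApprox d n).comp θ' (Lp_measurable θ'))) ?_ ?_ ?_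
    · filter_upwards [coeFn_simpleTrunc n θ, coeFn_simpleTrunc n θ'] with s h1 h2
      rw [h1, h2]
      rfl
    · have := norm_sub_le_norm_sub_add_norm_sub (simpleTrunc n θ) θ ζ
      have := norm_nonneg (simpleTrunc n θ' - θ')
      simp only [Rn]
      linarith
    · have := norm_sub_le_norm_sub_add_norm_sub (simpleTrunc n θ') θ' ζ
      have := norm_nonneg (simpleTrunc n θ - θ)
      simp only [Rn]
      linarith
  have hsub : ∀ p : Rd d × Rd d, ‖p.2 - p.1‖ ≤ ‖p.1‖ + ‖p.2‖ := fun p =>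
    (norm_sub_le _ _).trans (add_comm _ _).le
  refine le_of_tendsto_of_tendsto' (Tendsto.abs (Tendsto.sub
    ((hD.hasLDeriv _).tendsto_lift_simpleTrunc.sub (hD.hasLDeriv _).tendsto_lift_simpleTrunc) ?_))
    ((hR.const_mul C).mul ?_) hsimple
  · exact tendsto_integral_simpleTrunc θ θ' (k := fun p => segInt (D (law ζ)) p.1 p.2)
      (continuous_segInt (hD.continuous _)) (c := C) fun p =>
        (abs_segInt_le (hD.bound _) _ _).trans (mul_le_mul_of_nonneg_left (hsub p) hD.nonneg)
  · exact tendsto_integral_simpleTrunc θ θ' (k := fun p => ‖p.2 - p.1‖) (by fun_prop) (c := 1)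
      fun p => by rw [abs_norm, one_mul]; exact hsub p

end

theorem PM.memLp_of_map_eq {d : ℕ} {S : Type*} [MeasurableSpace S] {π : Measure S}
    {X : S → Rd d} (hX : Measurable X) {m : PM d 2} (h : π.map X = m.toMeasure) :
    MemLp X 2 π := by
  have hid : MemLp (id : Rd d → Rd d) 2 m.toMeasure := by
    refine ⟨by fun_prop, ?_⟩
    rw [eLpNorm_lt_top_iff_lintegral_rpow_enorm_lt_top (by norm_num) (by norm_num)]
    simpa [PM.toMeasure] using m.2.2
  rw [← h] at hid
  exact (memLp_map_measure_iff (by fun_prop) hX.aemeasurable).1 hid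

theorem PM.integrable_norm {d : ℕ} (m : PM d 2) : Integrable (fun y => ‖y‖) m.toMeasure :=
  ((PM.memLp_of_map_eq (X := id) measurable_id Measure.map_id).integrable one_le_two).norm

theorem PM.mix_toMeasure {d : ℕ} {ℓ : ℝ} (μ ν : PM d ℓ) (t : Set.Icc (0 : ℝ) 1) :
    (μ.mix ν t).toMeasure
      = ENNReal.ofReal (1 - t) • μ.toMeasure + ENNReal.ofReal t • ν.toMeasure := rfl

theorem PM.mix_self {d : ℕ} {ℓ : ℝ} (μ : PM d ℓ) (t : Set.Icc (0 : ℝ) 1) : μ.mix μ t = μ := by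
  refine PM.ext ?_
  rw [PM.mix_toMeasure, ← add_smul, ← ENNReal.ofReal_add (by linarith [t.2.2]) t.2.1]
  simp

theorem law_toLp {d : ℕ} {S : Type*} [MeasurableSpace S] {π : Measure S}
    [IsProbabilityMeasure π] {X : S → Rd d} (hX : MemLp X 2 π) {m : PM d 2}
    (h : π.map X = m.toMeasure) : law (hX.toLp X) = m :=
  PM.ext ((Measure.map_congr hX.coeFn_toLp).trans h)

/-! ### A coupling that moves only mass t -/

section MixCoupling

variable {d : ℕ}

/-- The law of `(x, x, x)` with probability `1 - t` and of `(a, y, x)` with probability `t`,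
where `x ∼ μ` and `y ∼ ν` are independent. -/
noncomputable def mixCoupling (μ ν : PM d 2) (a : Rd d) (t : Set.Icc (0 : ℝ) 1) :
    Measure (Rd d × Rd d × Rd d) :=
  ENNReal.ofReal (1 - t) • μ.toMeasure.map (fun x => (x, x, x))
    + ENNReal.ofReal t • (μ.toMeasure.prod ν.toMeasure).map (fun p => (a, p.2, p.1))

variable (μ ν : PM d 2) (a : Rd d) (t : Set.Icc (0 : ℝ) 1)

theorem mixCoupling_map {X : Rd d × Rd d × Rd d → Rd d} (hX : Measurable X) :
    (mixCoupling μ ν a t).map X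
      = ENNReal.ofReal (1 - t) • μ.toMeasure.map (fun x => X (x, x, x))
        + ENNReal.ofReal t • (μ.toMeasure.prod ν.toMeasure).map (fun p => X (a, p.2, p.1)) := by
  rw [mixCoupling, Measure.map_add _ _ hX, Measure.map_smul, Measure.map_smul,
    Measure.map_map hX (by fun_prop), Measure.map_map hX (by fun_prop)]
  rfl

theorem mixCoupling_map_fst : (mixCoupling μ ν a t).map (fun p => p.1)
    = (μ.mix (PM.dirac zero_le_two a) t).toMeasure := by
  rw [mixCoupling_map _ _ _ _ (by fun_prop), PM.mix_toMeasure, Measure.map_id', Measure.map_const,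
    measure_univ, one_smul]
  rfl

theorem mixCoupling_map_snd : (mixCoupling μ ν a t).map (fun p => p.2.1)
    = (μ.mix ν t).toMeasure := by
  rw [mixCoupling_map _ _ _ _ (by fun_prop), PM.mix_toMeasure, Measure.map_id']
  congr 2
  exact (Measure.map_snd_prod (μ := μ.toMeasure) (ν := ν.toMeasure)).trans (by simp)

theorem mixCoupling_map_trd : (mixCoupling μ ν a t).map (fun p => p.2.2) = μ.toMeasure := by
  rw [mixCoupling_map _ _ _ _ (by fun_prop), Measure.map_id']
  conv_rhs => rw [← PM.mix_self μ t, PM.mix_toMeasure]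
  congr 2
  exact (Measure.map_fst_prod (μ := μ.toMeasure) (ν := ν.toMeasure)).trans (by simp)

instance : IsProbabilityMeasure (mixCoupling μ ν a t) := by
  refine ⟨?_⟩
  -- The total mass is read off from the third marginal, which is μ.
  have h : (mixCoupling μ ν a t).map (fun p => p.2.2) Set.univ = 1 := by
    rw [mixCoupling_map_trd]
    exact measure_univ
  rwa [Measure.map_apply (by fun_prop) MeasurableSet.univ, Set.preimage_univ] at h

variable {μ ν a} in
theorem integral_mixCoupling {g : Rd d × Rd d × Rd d → ℝ} (hg : Measurable g)
    (h0 : ∀ x, g (x, x, x) = 0)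
    (hi : Integrable (fun p => g (a, p.2, p.1)) (μ.toMeasure.prod ν.toMeasure)) :
    ∫ p, g p ∂(mixCoupling μ ν a t)
      = t * ∫ p, g (a, p.2, p.1) ∂(μ.toMeasure.prod ν.toMeasure) := by
  have h1 : Integrable g (μ.toMeasure.map fun x => (x, x, x)) := by
    rw [integrable_map_measure hg.aestronglyMeasurable (by fun_prop)]
    exact (integrable_zero _ _ _).congr (Eventually.of_forall fun x => (h0 x).symm)
  have h2 : Integrable g ((μ.toMeasure.prod ν.toMeasure).map fun p => (a, p.2, p.1)) := by
    rw [integrable_map_measure hg.aestronglyMeasurable (by fun_prop)]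
    exact hi
  rw [mixCoupling, integral_add_measure (h1.smul_measure ENNReal.ofReal_ne_top)
    (h2.smul_measure ENNReal.ofReal_ne_top), integral_smul_measure, integral_smul_measure,
    integral_map (by fun_prop) hg.aestronglyMeasurable,
    integral_map (by fun_prop) hg.aestronglyMeasurable]
  simp [h0, ENNReal.toReal_ofReal t.2.1]

end MixCoupling

theorem measurable_segInt {d : ℕ} {D : Rd d → Rd d} (hD : Continuous D) {S : Type*}
    [MeasurableSpace S] {X Y : S → Rd d} (hX : Measurable X) (hY : Measurable Y) :
    Measurable fun s => segInt D (X s) (Y s) := by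
  let k := fun p : Rd d × Rd d => segInt D p.1 p.2
  have h : Measurable k := (continuous_segInt hD).measurable
  change Measurable (k ∘ fun s => (X s, Y s))
  exact Measurable.comp (g := k) h (hX.prodMk hY)

theorem continuous_segInt_right {d : ℕ} {D : Rd d → Rd d} (hD : Continuous D) (a : Rd d) :
    Continuous fun y => segInt D a y := by
  refine intervalIntegral.continuous_parametric_intervalIntegral_of_continuous' ?_ 0 1
  fun_prop

theorem norm_toLp_sub_sq {d : ℕ} {S : Type*} [MeasurableSpace S] {π : Measure S}
    {X Y : S → Rd d} (hX : MemLp X 2 π) (hY : MemLp Y 2 π) :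
    ‖hX.toLp X - hY.toLp Y‖ ^ 2 = ∫ s, ‖X s - Y s‖ ^ 2 ∂π := by
  rw [← MemLp.toLp_sub, ← real_inner_self_eq_norm_sq, L2.inner_def]
  refine integral_congr_ae ?_
  filter_upwards [(hX.sub hY).coeFn_toLp] with s hs
  rw [hs, real_inner_self_eq_norm_sq, Pi.sub_apply]

/-! ### Expansion along mixtures and conservativity -/

section Expansion

variable {d : ℕ} {Ω : Type*} [MeasurableSpace Ω] {P : Measure Ω} [IsProbabilityMeasure P]

theorem IsLipGrad.abs_sub_le_of_map_eq (hP : IsAtomless P) {V : PM d 2 → ℝ}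
    {D : PM d 2 → Rd d → Rd d} {C : ℝ} (hD : IsLipGrad P V D C) {S : Type*} [MeasurableSpace S]
    {π : Measure S} [IsProbabilityMeasure π] {X Y Z : S → Rd d} (hX : Measurable X)
    (hY : Measurable Y) (hZ : Measurable Z) {m m' μ : PM d 2} (hm : π.map X = m.toMeasure)
    (hm' : π.map Y = m'.toMeasure) (hμ : π.map Z = μ.toMeasure) {R : ℝ} (hR : 0 ≤ R)
    (hXZ : ∫ s, ‖X s - Z s‖ ^ 2 ∂π ≤ R ^ 2) (hYZ : ∫ s, ‖Y s - Z s‖ ^ 2 ∂π ≤ R ^ 2) :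
    |V m' - V m - ∫ s, segInt (D μ) (X s) (Y s) ∂π| ≤ C * R * ∫ s, ‖Y s - X s‖ ∂π := by
  have hX2 := PM.memLp_of_map_eq hX hm
  have hY2 := PM.memLp_of_map_eq hY hm'
  have hZ2 := PM.memLp_of_map_eq hZ hμ
  have key := hD.abs_lift_sub_le hP (θ := hX2.toLp X) (θ' := hY2.toLp Y) (ζ := hZ2.toLp Z) (R := R)
    (abs_le_of_sq_le_sq' ((norm_toLp_sub_sq hX2 hZ2).trans_le hXZ) hR).2
    (abs_le_of_sq_le_sq' ((norm_toLp_sub_sq hY2 hZ2).trans_le hYZ) hR).2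
  have e₁ : ∫ s, segInt (D μ) (hX2.toLp X s) (hY2.toLp Y s) ∂π
      = ∫ s, segInt (D μ) (X s) (Y s) ∂π := by
    refine integral_congr_ae ?_
    filter_upwards [hX2.coeFn_toLp, hY2.coeFn_toLp] with s h1 h2
    rw [h1, h2]
  have e₂ : ∫ s, ‖hY2.toLp Y s - hX2.toLp X s‖ ∂π = ∫ s, ‖Y s - X s‖ ∂π := by
    refine integral_congr_ae ?_
    filter_upwards [hX2.coeFn_toLp, hY2.coeFn_toLp] with s h1 h2
    rw [h1, h2]
  rwa [lift, lift, law_toLp hX2 hm, law_toLp hY2 hm', law_toLp hZ2 hμ, e₁, e₂] at key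

/-- Under `mixCoupling` both mixtures are at L²-distance O(√t) from μ and at L¹-distance O(t) from
each other, whence the order t√t. The constant K depends only on μ, ν and a, which later permits
integration over a family of functionals. -/
theorem exists_mix_dirac_expansion (hP : IsAtomless P) (μ ν : PM d 2) (a : Rd d) :
    ∃ K : ℝ, ∀ (V : PM d 2 → ℝ) (D : PM d 2 → Rd d → Rd d) (C : ℝ), IsLipGrad P V D C →
      ∀ t : Set.Icc (0 : ℝ) 1,
        |V (μ.mix ν t) - V (μ.mix (PM.dirac zero_le_two a) t)
          - t * ∫ y, segInt (D μ) a y ∂ν.toMeasure| ≤ C * K * (t * √t) := by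
  let ρ := μ.toMeasure.prod ν.toMeasure
  have hρ1 : MemLp (fun p : Rd d × Rd d => p.1) 2 ρ :=
    PM.memLp_of_map_eq (m := μ) measurable_fst (Measure.map_fst_prod.trans (by simp))
  have hρ2 : MemLp (fun p : Rd d × Rd d => p.2) 2 ρ :=
    PM.memLp_of_map_eq (m := ν) measurable_snd (Measure.map_snd_prod.trans (by simp))
  have hρa : MemLp (fun _ : Rd d × Rd d => a) 2 ρ := memLp_const a
  have hq1 : Integrable (fun p : Rd d × Rd d => ‖a - p.1‖ ^ 2) ρ :=
    (hρa.sub hρ1).integrable_norm_pow (by norm_num)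
  have hq2 : Integrable (fun p : Rd d × Rd d => ‖p.2 - p.1‖ ^ 2) ρ :=
    (hρ2.sub hρ1).integrable_norm_pow (by norm_num)
  have hl : Integrable (fun p : Rd d × Rd d => ‖p.2 - a‖) ρ :=
    ((hρ2.sub hρa).integrable one_le_two).norm
  let K₁ : ℝ := ∫ p, ‖a - p.1‖ ^ 2 ∂ρ
  let K₂ : ℝ := ∫ p, ‖p.2 - p.1‖ ^ 2 ∂ρ
  have hK₁ : 0 ≤ K₁ := integral_nonneg fun p => by positivity
  have hK₂ : 0 ≤ K₂ := integral_nonneg fun p => by positivity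
  refine ⟨√(K₁ + K₂) * ∫ p, ‖p.2 - a‖ ∂ρ, fun V D C hD t => ?_⟩
  let π := mixCoupling μ ν a t
  have ht0 : (0 : ℝ) ≤ t := t.2.1
  have hR : ∀ {k : ℝ}, k ≤ K₁ + K₂ → t * k ≤ (√t * √(K₁ + K₂)) ^ 2 := fun {k} hk => by
    rw [mul_pow, Real.sq_sqrt ht0, Real.sq_sqrt (add_nonneg hK₁ hK₂)]
    exact mul_le_mul_of_nonneg_left hk ht0
  have hmeas : Measurable fun p : Rd d × Rd d × Rd d => segInt (D μ) p.1 p.2.1 :=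
    measurable_segInt (hD.continuous μ) measurable_fst measurable_snd.fst
  have hsa := continuous_segInt_right (hD.continuous μ) a
  have hint : Integrable (fun p : Rd d × Rd d => segInt (D μ) a p.2) ρ :=
    (hl.const_mul C).mono' (hsa.comp continuous_snd).aestronglyMeasurable
      (Eventually.of_forall fun p => abs_segInt_le (hD.bound μ) a p.2)
  have hsnd : ∫ p, segInt (D μ) a p.2 ∂ρ = ∫ y, segInt (D μ) a y ∂ν.toMeasure := by
    simpa using integral_fun_snd (μ := μ.toMeasure) (ν := ν.toMeasure) fun y => segInt (D μ) a y
  have hXZ : ∫ p, ‖p.1 - p.2.2‖ ^ 2 ∂π ≤ (√t * √(K₁ + K₂)) ^ 2 := by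
    refine le_trans (le_of_eq ?_) (hR (k := K₁) (by linarith))
    exact integral_mixCoupling t (g := fun p => ‖p.1 - p.2.2‖ ^ 2) (by fun_prop) (by simp) hq1
  have hYZ : ∫ p, ‖p.2.1 - p.2.2‖ ^ 2 ∂π ≤ (√t * √(K₁ + K₂)) ^ 2 := by
    refine le_trans (le_of_eq ?_) (hR (k := K₂) (by linarith))
    exact integral_mixCoupling t (g := fun p => ‖p.2.1 - p.2.2‖ ^ 2) (by fun_prop) (by simp) hq2
  have hseg : ∫ p, segInt (D μ) p.1 p.2.1 ∂π = t * ∫ y, segInt (D μ) a y ∂ν.toMeasure := by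
    rw [← hsnd]
    exact integral_mixCoupling t hmeas (fun x => by simp [segInt]) hint
  have hnorm : ∫ p, ‖p.2.1 - p.1‖ ∂π = t * ∫ p, ‖p.2 - a‖ ∂ρ :=
    integral_mixCoupling t (g := fun p => ‖p.2.1 - p.1‖) (by fun_prop) (by simp) hl
  have key := hD.abs_sub_le_of_map_eq hP (π := π) (X := fun p => p.1) (Y := fun p => p.2.1)
    (Z := fun p => p.2.2) (by fun_prop)
    (by fun_prop) (by fun_prop) (mixCoupling_map_fst μ ν a t) (mixCoupling_map_snd μ ν a t)
    (mixCoupling_map_trd μ ν a t) (by positivity) hXZ hYZ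
  rw [hseg, hnorm] at key
  refine key.trans (le_of_eq ?_)
  ring

/-- First-order expansion along mixtures, with a remainder that is uniform in the functional. -/
theorem exists_mix_expansion (hP : IsAtomless P) (μ ν : PM d 2) :
    ∃ K : ℝ, ∀ (V : PM d 2 → ℝ) (D : PM d 2 → Rd d → Rd d) (C : ℝ), IsLipGrad P V D C →
      ∀ t : Set.Icc (0 : ℝ) 1,
        |V (μ.mix ν t) - V μ
          - t * ((∫ y, segInt (D μ) 0 y ∂ν.toMeasure) - ∫ y, segInt (D μ) 0 y ∂μ.toMeasure)|
          ≤ C * K * (t * √t) := by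
  obtain ⟨K₁, h₁⟩ := exists_mix_dirac_expansion hP μ ν 0
  obtain ⟨K₂, h₂⟩ := exists_mix_dirac_expansion hP μ μ 0
  refine ⟨K₁ + K₂, fun V D C hD t => ?_⟩
  have e₁ := h₁ V D C hD t
  have e₂ := h₂ V D C hD t
  -- With ν = μ the mixture is μ itself, so subtracting the two expansions eliminates the Dirac
  -- mixture.
  rw [PM.mix_self] at e₂
  refine le_trans (le_of_eq (congrArg _ ?_)) ((abs_sub _ _).trans
    ((add_le_add e₁ e₂).trans (le_of_eq ?_)))
  · ring
  · ring

theorem eq_zero_of_abs_le_mul_sqrt {c K : ℝ} (h : ∀ t ∈ Set.Ioc (0 : ℝ) 1, |c| ≤ K * √t) :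
    c = 0 := by
  have ht : Tendsto (fun t : ℝ => K * √t) (𝓝[>] 0) (𝓝 (K * √0)) :=
    ((Real.continuous_sqrt.const_mul K).tendsto 0).mono_left nhdsWithin_le_nhds
  rw [Real.sqrt_zero, mul_zero] at ht
  have hev : ∀ᶠ t in 𝓝[>] (0 : ℝ), |c| ≤ K * √t := by
    filter_upwards [Ioc_mem_nhdsGT (zero_lt_one' ℝ)] with t ht using h t ht
  exact abs_nonpos_iff.1 (ge_of_tendsto ht hev)

/-- The L-derivative is a conservative vector field. -/
theorem IsLipGrad.segInt_sub_segInt (hP : IsAtomless P) {V : PM d 2 → ℝ}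
    {D : PM d 2 → Rd d → Rd d} {C : ℝ} (hD : IsLipGrad P V D C) (μ : PM d 2) (a b : Rd d) :
    segInt (D μ) 0 b - segInt (D μ) 0 a = segInt (D μ) a b := by
  obtain ⟨K₁, h₁⟩ := exists_mix_dirac_expansion hP μ (PM.dirac zero_le_two b) 0
  obtain ⟨K₂, h₂⟩ := exists_mix_dirac_expansion hP μ (PM.dirac zero_le_two a) 0
  obtain ⟨K₃, h₃⟩ := exists_mix_dirac_expansion hP μ (PM.dirac zero_le_two b) a
  -- The change of V between the mixtures with δ_a and δ_b is expanded directly and through δ_0. The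
  -- two linear terms differ by O(t√t); dividing by t and letting t → 0 forces equality.
  refine sub_eq_zero.1 (eq_zero_of_abs_le_mul_sqrt (K := C * (K₁ + K₂ + K₃)) fun t ht => ?_)
  have e₁ := abs_le.1 (h₁ V D C hD ⟨t, ht.1.le, ht.2⟩)
  have e₂ := abs_le.1 (h₂ V D C hD ⟨t, ht.1.le, ht.2⟩)
  have e₃ := abs_le.1 (h₃ V D C hD ⟨t, ht.1.le, ht.2⟩)
  have hd : ∀ (z : Rd d) (g : Rd d → ℝ),
      ∫ y, g y ∂(PM.dirac (ℓ := 2) zero_le_two z).toMeasure = g z := fun z g => by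
    simp [PM.dirac, PM.toMeasure]
  rw [hd] at e₁ e₂ e₃
  refine le_of_mul_le_mul_left ?_ ht.1
  rw [← abs_of_pos ht.1, ← abs_mul, abs_of_pos ht.1]
  refine abs_le.2 ⟨?_, ?_⟩ <;> nlinarith [e₁.1, e₁.2, e₂.1, e₂.2, e₃.1, e₃.2]

theorem IsLipGrad.abs_segInt_sub_le (hP : IsAtomless P) {V : PM d 2 → ℝ}
    {D : PM d 2 → Rd d → Rd d} {C : ℝ} (hD : IsLipGrad P V D C) (μ : PM d 2) (a b : Rd d) :
    |segInt (D μ) 0 b - segInt (D μ) 0 a| ≤ C * ‖b - a‖ := by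
  rw [hD.segInt_sub_segInt hP]
  exact abs_segInt_le (hD.bound μ) a b

end Expansion

/-! ### Linear functional derivatives from the expansions -/

/-- A sufficient condition for a linear functional derivative. -/
theorem isLinDeriv_of_expansion {d : ℕ} {ℓ : ℝ} (hℓ : 1 ≤ ℓ) {W : PM d ℓ → ℝ} {μ : PM d ℓ}
    {f : Rd d → ℝ} (hf : Measurable f) {C : ℝ} (hC : ∀ y, |f y| ≤ C * ‖y‖)
    (h : ∀ ν : PM d ℓ, ∃ K : ℝ, ∀ t : Set.Icc (0 : ℝ) 1,
      |W (μ.mix ν t) - W μ - t * ((∫ y, f y ∂ν.toMeasure) - ∫ y, f y ∂μ.toMeasure)|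
        ≤ K * (t * √t)) :
    IsLinDeriv W μ f := by
  refine ⟨hf, ⟨|C|, fun y => (hC y).trans ?_⟩, fun ν => ?_⟩
  · refine (mul_le_mul_of_nonneg_right (le_abs_self C) (norm_nonneg y)).trans
      (mul_le_mul_of_nonneg_left ?_ (abs_nonneg C))
    rcases le_total ‖y‖ 1 with h1 | h1
    · exact h1.trans (le_add_of_nonneg_right (by positivity))
    · have := Real.rpow_le_rpow_of_exponent_le h1 hℓ
      rw [Real.rpow_one] at this
      linarith
  · obtain ⟨K, hK⟩ := h ν
    have h0 : W (μ.mix ν (Set.projIcc 0 1 zero_le_one (0 : ℝ))) = W μ := by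
      congr 1
      rw [Set.projIcc_left]
      exact PM.ext (by simp [PM.mix_toMeasure])
    rw [hasDerivWithinAt_iff_isLittleO, h0]
    have hbig : (fun t : ℝ => W (μ.mix ν (Set.projIcc 0 1 zero_le_one t)) - W μ
        - (t - 0) • ((∫ y, f y ∂ν.toMeasure) - ∫ y, f y ∂μ.toMeasure))
        =O[𝓝[≥] 0] fun t : ℝ => t * √t := by
      refine Asymptotics.IsBigO.of_bound |K| ?_
      filter_upwards [Icc_mem_nhdsGE (zero_lt_one' ℝ)] with t ht
      have e := hK ⟨t, ht⟩
      rw [Set.projIcc_of_mem zero_le_one ht, sub_zero, smul_eq_mul, Real.norm_eq_abs,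
        Real.norm_eq_abs, abs_of_nonneg (mul_nonneg ht.1 (Real.sqrt_nonneg t))]
      exact e.trans (mul_le_mul_of_nonneg_right (le_abs_self K)
        (mul_nonneg ht.1 (Real.sqrt_nonneg t)))
    refine hbig.trans_isLittleO ?_
    have hs : (fun t : ℝ => √t) =o[𝓝[≥] 0] fun _ => (1 : ℝ) := by
      rw [Asymptotics.isLittleO_one_iff]
      have := (Real.continuous_sqrt.tendsto 0).mono_left (nhdsWithin_le_nhds (s := Set.Ici 0))
      rwa [Real.sqrt_zero] at this
    simpa using (Asymptotics.isBigO_refl (fun t : ℝ => t) (𝓝[≥] 0)).mul_isLittleO hs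

theorem segInt_zero_left {d : ℕ} (D : Rd d → Rd d) (x : Rd d) :
    segInt D 0 x = ∫ t in (0 : ℝ)..1, ∑ i, x i * D (t • x) i := by
  simp [segInt, PiLp.inner_apply]

theorem segInt_self {d : ℕ} (D : Rd d → Rd d) (x : Rd d) : segInt D x x = 0 := by
  simp [segInt]

/-- The normalised second order linear functional derivative, in terms of the rows `H v i` of the
second L-derivative. -/
noncomputable def secondLin {d : ℕ} (H : Rd d → Fin d → Rd d → Rd d) (x y : Rd d) : ℝ :=
  ∫ t in (0 : ℝ)..1, ∑ i, x i * segInt (H (t • x) i) 0 y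

theorem sum_abs_coord_le {d : ℕ} (x : Rd d) : ∑ i, |x i| ≤ d * ‖x‖ := by
  refine (Finset.sum_le_card_nsmul _ _ ‖x‖ fun i _ => ?_).trans (by simp)
  exact PiLp.norm_apply_le x i

section SecondLin

variable {d : ℕ} {H : Rd d → Fin d → Rd d → Rd d}

theorem continuous_segInt_param (hH : ∀ i, Continuous fun q : Rd d × Rd d => H q.1 i q.2)
    (i : Fin d) : Continuous fun q : Rd d × Rd d => segInt (H q.1 i) 0 q.2 := by
  refine intervalIntegral.continuous_parametric_intervalIntegral_of_continuous' ?_ 0 1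
  have h : Continuous fun p : (Rd d × Rd d) × ℝ => H p.1.1 i (0 + p.2 • (p.1.2 - 0)) :=
    (hH i).comp (f := fun p : (Rd d × Rd d) × ℝ => (p.1.1, 0 + p.2 • (p.1.2 - 0))) (by fun_prop)
  exact h.inner (by fun_prop)

theorem continuous_secondLin_integrand (hH : ∀ i, Continuous fun q : Rd d × Rd d => H q.1 i q.2) :
    Continuous fun p : (Rd d × Rd d) × ℝ =>
      ∑ i, p.1.1 i * segInt (H (p.2 • p.1.1) i) 0 p.1.2 := by
  refine continuous_finsetSum _ fun i _ => Continuous.mul (by fun_prop) ?_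
  exact (continuous_segInt_param hH i).comp
    (f := fun p : (Rd d × Rd d) × ℝ => (p.2 • p.1.1, p.1.2)) (by fun_prop)

theorem continuous_secondLin (hH : ∀ i, Continuous fun q : Rd d × Rd d => H q.1 i q.2) :
    Continuous fun q : Rd d × Rd d => secondLin H q.1 q.2 :=
  intervalIntegral.continuous_parametric_intervalIntegral_of_continuous'
    (continuous_secondLin_integrand hH) 0 1

theorem secondLin_zero_right (x : Rd d) : secondLin H x 0 = 0 := by
  simp [secondLin, segInt_self]

theorem abs_sum_coord_mul_le (x : Rd d) {u : Fin d → ℝ} {c : ℝ} (hu : ∀ i, |u i| ≤ c) :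
    |∑ i, x i * u i| ≤ (∑ i, |x i|) * c := by
  refine (Finset.abs_sum_le_sum_abs _ _).trans ?_
  rw [Finset.sum_mul]
  refine Finset.sum_le_sum fun i _ => ?_
  rw [abs_mul]
  exact mul_le_mul_of_nonneg_left (hu i) (abs_nonneg _)

end SecondLin

section ClassM2

variable {d : ℕ} {Ω : Type*} [MeasurableSpace Ω] {P : Measure Ω} [IsProbabilityMeasure P]
  {DU : PM d 2 → Rd d → Rd d} {H : PM d 2 → Rd d → Fin d → Rd d → Rd d} {C : ℝ}

/-- Conservativity of each row turns the difference of two integrals from 0 into an integral from y'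
to y, so the bound on the row suffices and no factor |y| appears. -/
theorem abs_secondLin_sub_le (hP : IsAtomless P)
    (hV : ∀ v i, IsLipGrad P (fun m => DU m v i) (fun m => H m v i) C) (μ : PM d 2)
    (hH : ∀ i, Continuous fun q : Rd d × Rd d => H μ q.1 i q.2) (x y y' : Rd d) :
    |secondLin (H μ) x y - secondLin (H μ) x y'| ≤ (∑ i, |x i|) * (C * ‖y - y'‖) := by
  have hi : ∀ z, IntervalIntegrable (fun t : ℝ => ∑ i, x i * segInt (H μ (t • x) i) 0 z)
      volume 0 1 := fun z =>
    ((continuous_secondLin_integrand hH).comp (f := fun t : ℝ => ((x, z), t))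
      (by fun_prop)).intervalIntegrable 0 1
  rw [secondLin, secondLin, ← intervalIntegral.integral_sub (hi y) (hi y')]
  refine abs_intervalIntegral_le fun t _ => ?_
  rw [← Finset.sum_sub_distrib]
  simp only [← mul_sub]
  exact abs_sum_coord_mul_le x fun i => (hV (t • x) i).abs_segInt_sub_le hP μ y' y

/-- The mixture expansion is applied to m ↦ `DU m (r • x) i` for each r and i, weighted by x_i and
integrated over r. This is possible because its remainder constant does not depend on r. -/
theorem exists_secondLin_expansion (hP : IsAtomless P) (hU : ∀ μ, Continuous (DU μ))
    (hV : ∀ v i, IsLipGrad P (fun m => DU m v i) (fun m => H m v i) C)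
    (hH : ∀ μ i, Continuous fun q : Rd d × Rd d => H μ q.1 i q.2) (μ ν : PM d 2) (x : Rd d) :
    ∃ K : ℝ, ∀ t : Set.Icc (0 : ℝ) 1,
      |segInt (DU (μ.mix ν t)) 0 x - segInt (DU μ) 0 x
        - t * ((∫ y, secondLin (H μ) x y ∂ν.toMeasure) - ∫ y, secondLin (H μ) x y ∂μ.toMeasure)|
        ≤ K * (t * √t) := by
  obtain ⟨K, hK⟩ := exists_mix_expansion hP μ ν
  refine ⟨(∑ i, |x i|) * (C * K), fun t => ?_⟩
  let k : ℝ → Rd d → ℝ := fun r y => ∑ i, x i * segInt (H μ (r • x) i) 0 y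
  have hkm : Measurable (Function.uncurry k) :=
    ((continuous_secondLin_integrand (hH μ)).comp
      (f := fun p : ℝ × Rd d => ((x, p.2), p.1)) (by fun_prop)).measurable
  have hseg : ∀ v i y, |segInt (H μ v i) 0 y| ≤ C * ‖y‖ := fun v i y => by
    simpa using abs_segInt_le ((hV v i).bound μ) 0 y
  have hkb : ∀ r ∈ Set.Ioc (0 : ℝ) 1, ∀ y, |k r y| ≤ (∑ i, |x i|) * (C * ‖y‖) := fun r _ y =>
    abs_sum_coord_mul_le x fun i => hseg _ i y
  have hb : ∀ m : PM d 2, Integrable (fun y => (∑ i, |x i|) * (C * ‖y‖)) m.toMeasure :=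
    fun m => (m.integrable_norm.const_mul C).const_mul _
  have hcomm : ∀ m : PM d 2, ∫ y, secondLin (H μ) x y ∂m.toMeasure
      = ∫ r in (0 : ℝ)..1, ∫ y, k r y ∂m.toMeasure := fun m =>
    integral_intervalIntegral_comm hkm (hb m) hkb
  have hki : ∀ m : PM d 2, IntervalIntegrable (fun r => ∫ y, k r y ∂m.toMeasure) volume 0 1 :=
    fun m => intervalIntegrable_integral hkm (hb m) hkb
  have hDi : ∀ m : PM d 2, IntervalIntegrable (fun r : ℝ => ∑ i, x i * DU m (r • x) i)
      volume 0 1 := by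
    intro m
    have := hU m
    exact Continuous.intervalIntegrable (by fun_prop) 0 1
  have hsum : ∀ (m : PM d 2) (r : ℝ), ∫ y, k r y ∂m.toMeasure
      = ∑ i, x i * ∫ y, segInt (H μ (r • x) i) 0 y ∂m.toMeasure := by
    intro m r
    rw [integral_finsetSum]
    · exact Finset.sum_congr rfl fun i _ => integral_const_mul _ _
    · intro i _
      refine Integrable.const_mul ((m.integrable_norm.const_mul C).mono' ?_
        (Eventually.of_forall (hseg _ i))) _
      exact (continuous_segInt_right ((hV _ i).continuous μ) 0).aestronglyMeasurable
  rw [segInt_zero_left, segInt_zero_left, hcomm, hcomm,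
    ← intervalIntegral.integral_sub (hDi _) (hDi _),
    ← intervalIntegral.integral_sub (hki _) (hki _), ← intervalIntegral.integral_const_mul,
    ← intervalIntegral.integral_sub ((hDi _).sub (hDi _)) (((hki _).sub (hki _)).const_mul _)]
  refine abs_intervalIntegral_le fun r _ => ?_
  rw [hsum, hsum, ← Finset.sum_sub_distrib, ← Finset.sum_sub_distrib, Finset.mul_sum,
    ← Finset.sum_sub_distrib, mul_assoc]
  have e : ∀ i, x i * DU (μ.mix ν t) (r • x) i - x i * DU μ (r • x) i
      - t * (x i * ∫ y, segInt (H μ (r • x) i) 0 y ∂ν.toMeasure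
        - x i * ∫ y, segInt (H μ (r • x) i) 0 y ∂μ.toMeasure)
      = x i * (DU (μ.mix ν t) (r • x) i - DU μ (r • x) i
        - t * ((∫ y, segInt (H μ (r • x) i) 0 y ∂ν.toMeasure)
          - ∫ y, segInt (H μ (r • x) i) 0 y ∂μ.toMeasure)) := fun i => by ring
  simp only [e]
  exact abs_sum_coord_mul_le x fun i => hK _ _ C (hV (r • x) i) t

/-- The linear functional derivatives of orders one and two on `𝒫_ℓ`, `ℓ ≥ 2`. -/
theorem isLinDeriv_of_isLipGrad (hP : IsAtomless P) {U : PM d 2 → ℝ} (hU : IsLipGrad P U DU C)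
    (hV : ∀ v i, IsLipGrad P (fun m => DU m v i) (fun m => H m v i) C)
    (hH : ∀ μ i, Continuous fun q : Rd d × Rd d => H μ q.1 i q.2) {ℓ : ℝ} (hℓ : 2 ≤ ℓ)
    (μ : PM d ℓ) :
    IsLinDeriv (fun m : PM d ℓ => U (PM.incl zero_le_two hℓ m)) μ
        (segInt (DU (PM.incl zero_le_two hℓ μ)) 0) ∧
      ∀ x, IsLinDeriv (fun m : PM d ℓ => segInt (DU (PM.incl zero_le_two hℓ m)) 0 x) μ
        (secondLin (H (PM.incl zero_le_two hℓ μ)) x) := by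
  constructor
  · refine isLinDeriv_of_expansion (by linarith)
      (continuous_segInt_right (hU.continuous _) 0).measurable (C := C)
      (fun y => by simpa using abs_segInt_le (hU.bound _) 0 y) fun ν => ?_
    obtain ⟨K, hK⟩ := exists_mix_expansion hP (PM.incl zero_le_two hℓ μ) (PM.incl zero_le_two hℓ ν)
    exact ⟨C * K, hK U DU C hU⟩
  · intro x
    refine isLinDeriv_of_expansion (by linarith)
      ((continuous_secondLin (hH _)).comp (f := fun y => (x, y)) (by fun_prop)).measurable
      (C := (∑ i, |x i|) * C) (fun y => ?_) fun ν => ?_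
    · have := abs_secondLin_sub_le hP hV (PM.incl zero_le_two hℓ μ) (hH _) x y 0
      rwa [secondLin_zero_right, sub_zero, sub_zero, ← mul_assoc] at this
    · exact exists_secondLin_expansion hP (fun m => hU.continuous m) hV hH
        (PM.incl zero_le_two hℓ μ) (PM.incl zero_le_two hℓ ν) x

theorem linDerivIter_of_isLipGrad (hP : IsAtomless P) {U : PM d 2 → ℝ} (hU : IsLipGrad P U DU C)
    (hV : ∀ v i, IsLipGrad P (fun m => DU m v i) (fun m => H m v i) C)
    (hH : ∀ μ i, Continuous fun q : Rd d × Rd d => H μ q.1 i q.2) {ℓ : ℝ} (hℓ : 2 ≤ ℓ) :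
    HasLinDerivs 2 (fun m : PM d ℓ => U (PM.incl zero_le_two hℓ m)) ∧
      (∀ (μ : PM d ℓ) y, linDerivIter (fun m : PM d ℓ => U (PM.incl zero_le_two hℓ m)) 1 μ y
        = segInt (DU (PM.incl zero_le_two hℓ μ)) 0 (y 0)) ∧
      ∀ (μ : PM d ℓ) y, linDerivIter (fun m : PM d ℓ => U (PM.incl zero_le_two hℓ m)) 2 μ y
        = secondLin (H (PM.incl zero_le_two hℓ μ)) (y 0) (y 1) := by
  have hl : 0 ≤ ℓ := by linarith
  have key := isLinDeriv_of_isLipGrad hP hU hV hH hℓ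
  have h1 : ∀ (μ : PM d ℓ) y, linDerivIter (fun m : PM d ℓ => U (PM.incl zero_le_two hℓ m)) 1 μ y
      = segInt (DU (PM.incl zero_le_two hℓ μ)) 0 (y 0) := by
    intro μ y
    refine ((key μ).1.linDeriv_eq hl (y 0)).trans ?_
    rw [segInt_self, sub_zero]
  have h1' : ∀ y : Fin 1 → Rd d,
      (fun m => linDerivIter (fun m : PM d ℓ => U (PM.incl zero_le_two hℓ m)) 1 m y)
        = fun m => segInt (DU (PM.incl zero_le_two hℓ m)) 0 (y 0) := fun y => funext fun m => h1 m y
  refine ⟨fun i hi μ y => ?_, h1, fun μ y => ?_⟩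
  · interval_cases i
    · exact ⟨_, (key μ).1⟩
    · rw [h1']
      exact ⟨_, (key μ).2 (y 0)⟩
  -- The first derivative must be identified for all measures before it can be differentiated in the
  -- measure.
  · rw [linDerivIter, h1']
    refine (((key μ).2 (y 0)).linDeriv_eq hl (y 1)).trans ?_
    rw [secondLin_zero_right, sub_zero]

theorem norm_toLp_row_le_hsNorm (A : Matrix (Fin d) (Fin d) ℝ) (i : Fin d) :
    ‖WithLp.toLp 2 (A i)‖ ≤ hsNorm A := by
  rw [EuclideanSpace.norm_eq, hsNorm]
  refine Real.sqrt_le_sqrt ?_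
  simp only [Real.norm_eq_abs, sq_abs]
  exact Finset.single_le_sum (f := fun i => ∑ j, A i j ^ 2)
    (fun i _ => Finset.sum_nonneg fun j _ => sq_nonneg _) (Finset.mem_univ i)

theorem ClassM2.exists_isLipGrad {U : PM d 2 → ℝ} (h : ClassM2 P U) :
    ∃ (DU : PM d 2 → Rd d → Rd d) (H : PM d 2 → Rd d → Fin d → Rd d → Rd d) (C : ℝ),
      IsLipGrad P U DU C ∧
      (∀ v i, IsLipGrad P (fun m => DU m v i) (fun m => H m v i) C) ∧
      ∀ μ i, Continuous fun q : Rd d × Rd d => H μ q.1 i q.2 := by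
  obtain ⟨DU, -, DDU, C, hC, hDU, -, hDDU, hb, -, hbb, hl, -, hll⟩ := h
  have hU : IsLipGrad P U DU C := ⟨hC.le, hDU, hb, hl⟩
  have hrow : ∀ μ μ' v v' w w' i,
      ‖WithLp.toLp 2 (DDU μ v w i) - WithLp.toLp 2 (DDU μ' v' w' i)‖
        ≤ C * (‖v - v'‖ + ‖w - w'‖ + wasserstein μ μ') := fun μ μ' v v' w w' i =>
    (norm_toLp_row_le_hsNorm (DDU μ v w - DDU μ' v' w') i).trans (hll μ μ' v v' w w')
  refine ⟨DU, fun μ v i w => WithLp.toLp 2 (DDU μ v w i), C, hU, fun v i => ?_, fun μ i => ?_⟩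
  · refine ⟨hC.le, fun μ => hDDU μ v i, fun μ w => (norm_toLp_row_le_hsNorm _ i).trans (hbb μ v w),
      fun μ μ' w w' => ?_⟩
    have := hrow μ μ' v v w w' i
    rwa [sub_self, norm_zero, zero_add] at this
  · have hW : wasserstein μ μ ≤ 0 := by
      obtain ⟨-, θ, -, rfl, -⟩ := hDU μ
      simpa using wasserstein_law_le θ θ
    -- The norm on the product is the maximum, so each of the two increments contributes C.
    refine (LipschitzWith.of_dist_le_mul (K := ⟨2 * C, by positivity⟩) fun q q' => ?_).continuous
    rw [dist_eq_norm, dist_eq_norm]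
    refine (hrow μ μ q.1 q'.1 q.2 q'.2 i).trans ?_
    have h1 := norm_fst_le (q - q')
    have h2 := norm_snd_le (q - q')
    rw [Prod.fst_sub] at h1
    rw [Prod.snd_sub] at h2
    change _ ≤ 2 * C * ‖q - q'‖
    nlinarith

end ClassM2

/-! ### Growth inequalities and conclusion -/

theorem le_one_add_rpow {r p : ℝ} (hr : 0 ≤ r) (hp : 1 ≤ p) : r ≤ 1 + r ^ p := by
  rcases le_total r 1 with h | h
  · exact h.trans (le_add_of_nonneg_right (by positivity))
  · have := Real.rpow_le_rpow_of_exponent_le h hp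
    rw [Real.rpow_one] at this
    linarith

theorem mul_le_one_add_rpow {r s p : ℝ} (hr : 0 ≤ r) (hs : 0 ≤ s) (hp : 2 ≤ p) :
    r * s ≤ 1 + (r ^ p + s ^ p) := by
  have h : ∀ {u : ℝ}, 0 ≤ u → u ^ 2 ≤ 1 + u ^ p := fun {u} hu => by
    have h1 := le_one_add_rpow (sq_nonneg u) (p := p / 2) (by linarith)
    have h2 : (u ^ 2) ^ (p / 2) = u ^ p := by
      rw [← Real.rpow_natCast, ← Real.rpow_mul hu]
      congr 1
      push_cast
      ring
    rwa [h2] at h1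
  nlinarith [h hr, h hs, sq_nonneg (r - s), Real.rpow_nonneg hr p, Real.rpow_nonneg hs p]

end WassersteinCalculus

open WassersteinCalculus

theorem mainTheorem11 {Ω : Type*} [MeasurableSpace Ω] (P : Measure Ω) [IsProbabilityMeasure P]
    (hP : IsAtomless P) (d : ℕ) (U : PM d 2 → ℝ) (hU : ClassM2 P U) :
    (HasLinDerivs 2 U ∧
      ∃ C : ℝ, ∀ (μ : PM d 2) (x y y' : Rd d),
        |linDerivIter U 2 μ ![x, y] - linDerivIter U 2 μ ![x, y']| ≤ C * ‖x‖ * ‖y - y'‖) ∧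
    ∀ (ℓ : ℝ) (hℓ : 4 ≤ ℓ),
      CLTHypotheses
        (fun μ : PM d ℓ => U (PM.incl zero_le_two (le_trans (by norm_num) hℓ) μ)) := by
  obtain ⟨DU, H, C, hDU, hV, hH⟩ := hU.exists_isLipGrad
  have hC := hDU.nonneg
  have hlip : ∀ (μ : PM d 2) (x y y' : Rd d),
      |secondLin (H μ) x y - secondLin (H μ) x y'| ≤ d * C * ‖x‖ * ‖y - y'‖ := by
    intro μ x y y'
    refine (abs_secondLin_sub_le hP hV μ (hH μ) x y y').trans ?_
    refine (mul_le_mul_of_nonneg_right (sum_abs_coord_le x) (by positivity)).trans (le_of_eq ?_)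
    ring
  have hfirst : ∀ (μ : PM d 2) (x : Rd d), |segInt (DU μ) 0 x| ≤ C * ‖x‖ := fun μ x => by
    simpa using abs_segInt_le (hDU.bound μ) 0 x
  have hsecond : ∀ (μ : PM d 2) (x y : Rd d), |secondLin (H μ) x y| ≤ d * C * (‖x‖ * ‖y‖) := by
    intro μ x y
    have := hlip μ x y 0
    rwa [secondLin_zero_right, sub_zero, sub_zero, mul_assoc (d * C : ℝ)] at this
  refine ⟨?_, fun ℓ hℓ => ?_⟩
  · obtain ⟨h0, -, h2⟩ := linDerivIter_of_isLipGrad hP hDU hV hH (le_refl 2)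
    have e : (fun m : PM d 2 => U (PM.incl zero_le_two (le_refl 2) m)) = U := rfl
    rw [e] at h0 h2
    refine ⟨h0, d * C, fun μ x y y' => ?_⟩
    rw [h2, h2]
    exact hlip _ x y y'
  · have hℓ2 : (2 : ℝ) ≤ ℓ := le_trans (by norm_num) hℓ
    obtain ⟨h0, h1, h2⟩ := linDerivIter_of_isLipGrad hP hDU hV hH hℓ2
    have hmom : ∀ (μ : PM d ℓ) (p : ℝ), 0 ≤ if 0 < ℓ then μ.moment ^ p else 0 := by
      intro μ p
      rw [if_pos (by linarith)]
      exact Real.rpow_nonneg (integral_nonneg fun x => by positivity) _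
    have hm1 : ∀ μ : PM d ℓ, Measurable
        (linDerivIter (fun m : PM d ℓ => U (PM.incl zero_le_two hℓ2 m)) 1 μ) := by
      intro μ
      rw [funext (h1 μ)]
      exact (continuous_segInt_right (hDU.continuous _) 0).measurable.comp (measurable_pi_apply 0)
    have hm2 : ∀ μ : PM d ℓ, Measurable
        (linDerivIter (fun m : PM d ℓ => U (PM.incl zero_le_two hℓ2 m)) 2 μ) := by
      intro μ
      rw [funext (h2 μ)]
      exact ((continuous_secondLin (hH _)).comp
        (f := fun y : Fin 2 → Rd d => (y 0, y 1)) (by fun_prop)).measurable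
    have hb1 : ∀ (p : ℝ), 1 ≤ p → ∀ (μ : PM d ℓ) (x : Fin 1 → Rd d),
        |linDerivIter (fun m : PM d ℓ => U (PM.incl zero_le_two hℓ2 m)) 1 μ x|
          ≤ C * (1 + (∑ a, ‖x a‖ ^ p) + if 0 < ℓ then μ.moment ^ (p / ℓ) else 0) := by
      intro p hp μ x
      rw [h1]
      refine (hfirst _ _).trans (mul_le_mul_of_nonneg_left ?_ hC)
      have := le_one_add_rpow (norm_nonneg (x 0)) hp
      rw [Fin.sum_univ_one]
      linarith [hmom μ (p / ℓ)]
    -- C + dC serves both orders in the second class. The Hölder exponent is 1 with constant dC,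
    -- because |x| ≤ 1 + |x|^(ℓ/2). The moment terms are nonnegative and are simply discarded.
    refine ⟨⟨fun i hi => h0 i (by omega), ?_, C, ?_⟩, ⟨h0, ?_, C + d * C, ?_⟩, 1, ?_, d * C, ?_⟩
    · intro i hi
      obtain rfl : i = 1 := by simpa using hi
      exact hm1
    · intro i hi
      obtain rfl : i = 1 := by simpa using hi
      exact hb1 _ (by linarith)
    · intro i hi
      obtain ⟨hi1, hi2⟩ := Finset.mem_Icc.1 hi
      interval_cases i
      · exact hm1
      · exact hm2
    · intro i hi μ x
      obtain ⟨hi1, hi2⟩ := Finset.mem_Icc.1 hi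
      have hS : 0 ≤ 1 + (∑ a, ‖x a‖ ^ ℓ) + if 0 < ℓ then μ.moment ^ (ℓ / ℓ) else 0 :=
        add_nonneg (by positivity) (hmom μ _)
      have hdC : 0 ≤ d * C := by positivity
      interval_cases i
      · refine (hb1 ℓ (by linarith) μ x).trans (mul_le_mul_of_nonneg_right ?_ hS)
        linarith
      · rw [h2]
        refine (hsecond _ _ _).trans ((mul_le_mul_of_nonneg_left ?_ hdC).trans
          (mul_le_mul_of_nonneg_right (by linarith : d * C ≤ C + d * C) hS))
        have := mul_le_one_add_rpow (norm_nonneg (x 0)) (norm_nonneg (x 1)) hℓ2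
        rw [Fin.sum_univ_two]
        linarith [hmom μ (ℓ / ℓ)]
    · rw [if_neg (by linarith), min_eq_right (by linarith), zero_add]
      exact ⟨one_pos, le_rfl⟩
    · intro μ x y y'
      have hpos : 0 < 1 + ‖x‖ ^ (ℓ / 2) := by positivity
      rw [h2, h2, ← sub_div, abs_div, abs_of_pos hpos, div_le_iff₀ hpos, Real.rpow_one]
      refine (hlip _ x y y').trans ?_
      have hx := le_one_add_rpow (norm_nonneg x) (p := ℓ / 2) (by linarith)
      have hK : 0 ≤ d * C * ‖y - y'‖ := by positivity
      calc d * C * ‖x‖ * ‖y - y'‖ = d * C * ‖y - y'‖ * ‖x‖ := by ring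
        _ ≤ d * C * ‖y - y'‖ * (1 + ‖x‖ ^ (ℓ / 2)) := mul_le_mul_of_nonneg_left hx hK
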